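/- **Problem.** Let $\mathbb R^N=\mathbb R^{N_1}\times\dots\times\mathbb R^{N_n}$ with the Euclidean norm $\|\cdot\|$; write $x_i$ for the $i$-th block of $x$ and $\nabla_i f$ for the $i$-th block of $\nabla f$. Let $F=f+\Psi$ with $\Psi(x)=\sum_{i=1}^n\Psi_i(x_i)$, where $f:\mathbb R^N\to\mathbb R$ is differentiable (possibly nonconvex), each $\Psi_i:\mathbb R^{N_i}\to\mathbb R\cup\{+\infty\}$ is arbitrary (possibly nonconvex and nonsmooth), and there are $L_i>0$ with $\|\nabla_i f(x+h)-\nabla_i f(x)\|\le L_i\|h\|$ for all $x$ and all $h$ with $h_j=0$ for $j\ne i$. Assume that $F$ attains its minimum; $F^*$ denotes the minimum, and $L_f=\sum_i L_i$. **Method (RNBPG).** Choose $x^0$ with $F(x^0)<\infty$, $\eta>1$, $\sigma>0$, $0<\underline\theta\le\bar\theta$, an integer $M\ge0$, and $0<p_i<1$ with $\sum_{i=1}^n p_i=1$. At iteration $k=0,1,\dots$ pick $i_k=i$ with probability $p_i$, independently of the past. Choose $\theta^0\in[\underline\theta,\bar\theta]$; for $j=0,1,\dots$ compute a step $d^k$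 whose blocks other than the $i$-th vanish and with $$(d^k)_i\in\arg\min_s\Big\{\nabla_i f(x^k)^Ts+\tfrac{\theta^0\eta^j}{2}\|s\|^2+\Psi_i(x^k_i+s)\Big\},$$ and stop at the first $j$ for which $$F(x^k+d^k)\le\max_{\max\{k-M,0\}\le l\le k}F(x^l)-\tfrac{\sigma}{2}\|d^k\|^2 .$$ Set $x^{k+1}=x^k+d^k$. All choices made by the method (of $\theta^0$ and of minimizers) are functions of the block indices picked so far, and the minimizers that it computes are assumed to exist. Let $\bar d^{k,i}$ be the step $d^k$ obtained if $i_k=i$, let $\bar d^k=\sum_{i=1}^n\bar d^{k,i}$ and $\tilde x^k=x^k+\bar d^k$; these are functions of $i_0,\dots,i_{k-1}$. Below, $\partial\Psi$ is the Clarke subdifferential, and $x$ is called stationary if $0\in\nabla f(x)+\partial\Psi(x)$. **Theorem.** Let $\Omega(x^0)=\{x: F(x)\le F(x^0)\}$. Assume that $F$ is uniformly continuous on $\Omega(x^0)$ and that $\Psi$ is locally Lipschitz continuous in $\Omega(x^0)$, i.e. every point of $\Omega(x^0)$ has a neighbourhood in $\mathbb R^N$ on which $\Psi$ is finite and Lipschitz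 continuous. (i) $\lim_{k\to\infty}\mathbb E\|\bar d^k\|=0$. If $\nabla f$ is Lipschitz continuous on $\mathbb R^N$ (with any constant), then also $\lim_{k\to\infty}\mathbb E\big[\operatorname{dist}(-\nabla f(\tilde x^k),\partial\Psi(\tilde x^k))\big]=0$. (ii) If every $\Psi_i$ is lower semicontinuous (closed), then almost surely every accumulation point of $\{x^k\}$ is stationary. (iii) Suppose that $\nabla f$ is Lipschitz continuous on $\mathbb R^N$ (with any constant) and that $F$ is uniformly continuous on $$\mathcal S=\Big\{x: F(x)\le F(x^0)+\max\big\{\tfrac n\sigma|L_f-\underline\theta|,\,1\big\}\,(F(x^0)-F^*)\Big\}.$$ Then $F(x^k)$ and $F(\tilde x^k)$ are finite and $\lim_{k\to\infty}\mathbb E|F(x^k)-F(\tilde x^k)|=0$. Moreover, for every $\epsilon>0$ and $\rho\in(0,1)$ there is $K$ such that for all $k\ge K$, $$\mathbb P\Big(\max\big\{\|x^k-\tilde x^k\|,\ |F(x^k)-F(\tilde x^k)|,\ \operatorname{dist}(-\nabla f(\tilde x^k),\partial\Psi(\tilde x^k))\big\}\le\epsilon\Big)\ge1-\rho .$$ 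-/

import Mathlib

open Filter Topology MeasureTheory ProbabilityTheory
open scoped RealInnerProductSpace

noncomputable section

namespace RNBPG

/-- The Euclidean space `ℝ^N = ℝ^{N_1} × ⋯ × ℝ^{N_n}`, with the Euclidean norm; the `i`-th block
of a point `x` is `x i`. -/
abbrev BlockSpace {n : ℕ} (N : Fin n → ℕ) : Type :=
  PiLp 2 (fun i : Fin n => EuclideanSpace ℝ (Fin (N i)))

variable {n : ℕ} {N : Fin n → ℕ}

/-- The vector of `ℝ^N` whose `i`-th block is `s` and whose other blocks vanish. -/
def embed (i : Fin n) (s : EuclideanSpace ℝ (Fin (N i))) : BlockSpace N :=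
  WithLp.toLp 2 (Pi.single i s)

/-- The block separable function `Ψ(x) = ∑ i, Ψ_i(x_i)`. -/
def sep (Ψ : (i : Fin n) → EuclideanSpace ℝ (Fin (N i)) → EReal) (x : BlockSpace N) : EReal :=
  ∑ i, Ψ i (x i)

/-- The objective function `F = f + Ψ`. -/
def objective (f : BlockSpace N → ℝ)
    (Ψ : (i : Fin n) → EuclideanSpace ℝ (Fin (N i)) → EReal) (x : BlockSpace N) : EReal :=
  (f x : EReal) + sep Ψ x

/-- The gradient of `f` is block-coordinate-wise Lipschitz continuous with constants `L i`. -/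
def BlockLipschitzGradient (f : BlockSpace N → ℝ) (L : Fin n → ℝ) : Prop :=
  ∀ (i : Fin n) (x h : BlockSpace N), (∀ j, j ≠ i → h j = 0) →
    ‖gradient f (x + h) i - gradient f x i‖ ≤ L i * ‖h‖

/-- The level set `Ω(x⁰) = {x : F(x) ≤ F(x⁰)}`. -/
def levelSet (f : BlockSpace N → ℝ)
    (Ψ : (i : Fin n) → EuclideanSpace ℝ (Fin (N i)) → EReal) (x0 : BlockSpace N) :
    Set (BlockSpace N) :=
  {x | objective f Ψ x ≤ objective f Ψ x0}

/-- The set `{x : F(x) ≤ F(x⁰) + max {(n/σ) |L_f - θlo|, 1} (F(x⁰) - F⋆)}`, where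
`L_f = ∑ i, L i` and `F⋆` is the optimal value. -/
def enlargedLevelSet (f : BlockSpace N → ℝ)
    (Ψ : (i : Fin n) → EuclideanSpace ℝ (Fin (N i)) → EReal) (L : Fin n → ℝ) (σ θlo : ℝ)
    (x0 : BlockSpace N) : Set (BlockSpace N) :=
  {x | objective f Ψ x ≤
    (((objective f Ψ x0).toReal + max ((n : ℝ) / σ * |∑ i, L i - θlo|) 1 *
      ((objective f Ψ x0).toReal - (⨅ y, objective f Ψ y).toReal) : ℝ) : EReal)}

section Clarke

variable {E : Type*} [NormedAddCommGroup E] [InnerProductSpace ℝ E]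

/-- `φ` is finite and Lipschitz continuous on some neighbourhood of `x`. -/
def LipschitzNear (φ : E → EReal) (x : E) : Prop :=
  ∃ U ∈ 𝓝 x, ∃ K : NNReal, (∀ y ∈ U, φ y ≠ ⊤ ∧ φ y ≠ ⊥) ∧
    LipschitzOnWith K (fun y => (φ y).toReal) U

/-- Clarke's generalized directional derivative
`φ°(x; v) = limsup_{y → x, t ↓ 0} (φ(y + t v) - φ(y)) / t`. -/
def clarkeDeriv (φ : E → EReal) (x v : E) : EReal :=
  limsup (fun q : E × ℝ =>
    ((((φ (q.1 + q.2 • v)).toReal - (φ q.1).toReal) / q.2 : ℝ) : EReal)) (𝓝 x ×ˢ 𝓝[>] (0 : ℝ))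

/-- The Clarke subdifferential of `φ` at a point `x` near which `φ` is Lipschitz continuous
(by convention, the set is empty at all other points). -/
def clarkeSubdifferential (φ : E → EReal) (x : E) : Set E :=
  {ζ | LipschitzNear φ x ∧ ∀ v : E, ((⟪ζ, v⟫ : ℝ) : EReal) ≤ clarkeDeriv φ x v}

end Clarke

/-- `x` is a stationary point of `min f + Ψ`, that is, `0 ∈ ∇f(x) + ∂Ψ(x)`. -/
def IsStationary (f : BlockSpace N → ℝ)
    (Ψ : (i : Fin n) → EuclideanSpace ℝ (Fin (N i)) → EReal) (x : BlockSpace N) : Prop :=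
  -gradient f x ∈ clarkeSubdifferential (sep Ψ) x

/-- `s ∈ argmin_s {∇_i f(x)ᵀ s + (θ/2) ‖s‖² + Ψ_i(x_i + s)}`. -/
def IsProxStep (f : BlockSpace N → ℝ)
    (Ψ : (i : Fin n) → EuclideanSpace ℝ (Fin (N i)) → EReal) (x : BlockSpace N) (i : Fin n)
    (θ : ℝ) (s : EuclideanSpace ℝ (Fin (N i))) : Prop :=
  ∀ s' : EuclideanSpace ℝ (Fin (N i)),
    ((⟪gradient f x i, s⟫ + θ / 2 * ‖s‖ ^ 2 : ℝ) : EReal) + Ψ i (x i + s) ≤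
      ((⟪gradient f x i, s'⟫ + θ / 2 * ‖s'‖ ^ 2 : ℝ) : EReal) + Ψ i (x i + s')

/-- The acceptance test of the inner loop for the trial step `d` at `x`; `R` is the reference
value, the maximum of the last objective values. -/
def Accepts (f : BlockSpace N → ℝ)
    (Ψ : (i : Fin n) → EuclideanSpace ℝ (Fin (N i)) → EReal) (σ : ℝ) (x : BlockSpace N)
    (R : EReal) (d : BlockSpace N) : Prop :=
  objective f Ψ (x + d) ≤ R - ((σ / 2 * ‖d‖ ^ 2 : ℝ) : EReal)

/-- `d` is an output of the inner loop at the point `x` with block `i`: for some initial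
`θ⁰ ∈ [θlo, θhi]` the loop computes for `m = 0, 1, …` a minimizer `s m` of the proximal subproblem
with parameter `θ⁰ η^m`, and it stops at the first index `j` whose trial step is accepted. -/
def IsInnerOutput (f : BlockSpace N → ℝ)
    (Ψ : (i : Fin n) → EuclideanSpace ℝ (Fin (N i)) → EReal) (η σ θlo θhi : ℝ)
    (x : BlockSpace N) (R : EReal) (i : Fin n) (d : BlockSpace N) : Prop :=
  ∃ θ0 ∈ Set.Icc θlo θhi, ∃ (j : ℕ) (s : ℕ → EuclideanSpace ℝ (Fin (N i))),
    (∀ m ≤ j, IsProxStep f Ψ x i (θ0 * η ^ m) (s m)) ∧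
    (∀ m < j, ¬ Accepts f Ψ σ x R (embed i (s m))) ∧
    Accepts f Ψ σ x R (embed i (s j)) ∧
    d = embed i (s j)

/-- A run of the RNBPG method. For a realization `ξ = (i_0, i_1, …)` of the block indices, `x k ξ`
is the iterate `x^k` and `d k ξ i` is the step found at iteration `k` if the block picked there is
`i`. It depends on the indices picked before iteration `k` only. -/
structure IsRun (f : BlockSpace N → ℝ)
    (Ψ : (i : Fin n) → EuclideanSpace ℝ (Fin (N i)) → EReal) (η σ θlo θhi : ℝ) (M : ℕ)
    (x0 : BlockSpace N) (x : ℕ → (ℕ → Fin n) → BlockSpace N)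
    (d : ℕ → (ℕ → Fin n) → Fin n → BlockSpace N) : Prop where
  init : ∀ ξ, x 0 ξ = x0
  nonanticipating : ∀ (k : ℕ) (ξ ξ' : ℕ → Fin n), (∀ t < k, ξ t = ξ' t) → d k ξ = d k ξ'
  inner : ∀ (k : ℕ) (ξ : ℕ → Fin n) (i : Fin n),
    IsInnerOutput f Ψ η σ θlo θhi (x k ξ)
      (⨆ j ∈ Finset.Icc (k - M) k, objective f Ψ (x j ξ)) i (d k ξ i)
  update : ∀ (k : ℕ) (ξ : ℕ → Fin n), x (k + 1) ξ = x k ξ + d k ξ (ξ k)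

end RNBPG

end

/-!
For every realization of the block indices, the reference values `max_{k-M ≤ l ≤ k} F(x^l)`
decrease to a limit. Going backwards from the indices at which they are attained, the acceptance
test and the uniform continuity of `F` on the level set of `x⁰` show that the steps which the method
takes tend to zero (`tendsto_zero_of_nonmonotone_decrease`); no probability is involved here.

The passage from the steps taken to the full step `dbar^k`, which collects the steps for all blocks,
is probabilistic. If the step for block `i` exceeded a fixed `ε > 0` infinitely often, then, since
block `i` is picked with a positive probability independently of the past, it would almost surely be
picked at infinitely many of these iterations, and the steps taken would not vanish. This is Lévy's
extension of the Borel–Cantelli lemma (`ae_eventually_notMem`, `ae_tendsto_zero`). Hence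
`dbar^k → 0` almost surely. Since the steps are bounded, the expectations converge by dominated convergence.

The rest is deterministic. The inner loop accepts every parameter above `L i + σ`, so its parameters
`θ_i` are bounded. The blocks `dbar_i` of the full step solve the proximal subproblems, so that
`xtilde^k = x^k + dbar^k` minimizes `Ψ` plus a quadratic function, and the vector with blocks
`-∇_i f(x^k) - θ_i dbar_i` is a Clarke subgradient of `Ψ` at `xtilde^k`
(`exists_mem_clarkeSubdifferential`). This bounds the distance from `-∇f(xtilde^k)` to the
subdifferential by a multiple of `‖dbar^k‖` if `∇f` is Lipschitz. At cluster points it yields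
stationarity, because the graph of the subdifferential is closed and `∇f` is continuous
(`continuous_gradient`). Finally, `F(xtilde^k) ≤ F(x^k) + (K/2) ‖dbar^k‖²`, where `K` is a Lipschitz
constant of `∇f`. So `xtilde^k` lies in the enlarged level set as soon as `dbar^k` is short, and
there `F` is uniformly continuous (`AdmissibleRun.exists_abs_sub_lt`).
-/

open Filter Topology MeasureTheory ProbabilityTheory
open scoped RealInnerProductSpace

namespace RNBPG

/-! ### Nonmonotone decrease of a real sequence -/

/-- Going backwards from an index at which `a` is close to the limit `r` of the reference values:
the sufficient decrease then forces a small step, hence a small change of `a`, so that `a` is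
close to `r` at the preceding index as well. -/
lemma exists_lower_bound_of_nonmonotone_decrease {a δ R : ℕ → ℝ} {c r : ℝ} (hc : 0 < c)
    (hR : Tendsto R atTop (𝓝 r)) (hdec : ∀ k, a (k + 1) ≤ R k - c * δ k ^ 2)
    (hcont : ∀ ε > 0, ∃ η > 0, ∀ k, δ k < η → |a (k + 1) - a k| < ε) (j : ℕ) :
    ∀ ε > 0, ∃ ε' > 0, ∃ K, ∀ k ≥ K, ∀ i ≤ j, r - ε' ≤ a (k + i) → r - ε ≤ a k := by
  induction j with
  | zero =>
    intro ε hε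
    refine ⟨ε, hε, 0, fun k _ i hi h => ?_⟩
    obtain rfl : i = 0 := by omega
    simpa using h
  | succ j ih =>
    intro ε hε
    obtain ⟨η, hη, hη'⟩ := hcont (ε / 2) (by positivity)
    obtain ⟨ε', hε', K, hK⟩ := ih (min (ε / 2) (c * η ^ 2 / 2)) (by positivity)
    have hev : ∀ᶠ k in atTop, R k < r + c * η ^ 2 / 2 :=
      hR.eventually_lt_const (by linarith [show 0 < c * η ^ 2 / 2 by positivity])
    obtain ⟨K', hK'⟩ := eventually_atTop.1 hev
    refine ⟨min ε ε', lt_min hε hε', max K K', fun k hk i hi h => ?_⟩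
    rcases i with _ | i
    · have := min_le_left ε ε'
      simp only [add_zero] at h
      linarith
    have h1 := hK (k + 1) (by have := le_max_left K K'; omega) i (by omega)
      (by rw [show k + 1 + i = k + (i + 1) by ring]; linarith [min_le_right ε ε'])
    have h2 := hK' k (le_trans (le_max_right _ _) hk)
    have h3 := hdec k
    have h4 := min_le_left (ε / 2) (c * η ^ 2 / 2)
    have h5 := min_le_right (ε / 2) (c * η ^ 2 / 2)
    have h6 : δ k < η := by
      refine lt_of_pow_lt_pow_left₀ 2 hη.le ?_
      refine lt_of_mul_lt_mul_left ?_ hc.le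
      linarith
    have h7 := abs_lt.1 (hη' k h6)
    linarith [h7.1, h7.2]

/-- If a sequence that is bounded below decreases sufficiently with respect to the maximum of its
last values, and its increments are small whenever the steps are small, then the steps vanish. -/
lemma tendsto_zero_of_nonmonotone_decrease {a δ : ℕ → ℝ} {c b : ℝ} {M : ℕ} (hc : 0 < c)
    (hδ : ∀ k, 0 ≤ δ k) (hb : ∀ k, b ≤ a k)
    (hdec : ∀ k, ∃ l ∈ Finset.Icc (k - M) k, a (k + 1) ≤ a l - c * δ k ^ 2)
    (hcont : ∀ ε > 0, ∃ η > 0, ∀ k, δ k < η → |a (k + 1) - a k| < ε) :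
    Tendsto δ atTop (𝓝 0) := by
  have hne : ∀ k, (Finset.Icc (k - M) k).Nonempty := fun k => Finset.nonempty_Icc.2 (Nat.sub_le k M)
  set R : ℕ → ℝ := fun k => (Finset.Icc (k - M) k).sup' (hne k) a with hRdef
  have haR : ∀ k, ∀ l ∈ Finset.Icc (k - M) k, a l ≤ R k := fun k l hl => Finset.le_sup' a hl
  have hdecR : ∀ k, a (k + 1) ≤ R k - c * δ k ^ 2 := fun k => by
    obtain ⟨l, hl, h⟩ := hdec k
    linarith [haR k l hl]
  have hanti : Antitone R := by
    refine antitone_nat_of_succ_le fun k => Finset.sup'_le _ _ fun l hl => ?_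
    rw [Finset.mem_Icc] at hl
    rcases eq_or_lt_of_le hl.2 with rfl | hlt
    · have := hdecR k
      have : 0 ≤ c * δ k ^ 2 := by positivity
      linarith
    · exact haR k l (Finset.mem_Icc.2 ⟨by omega, by omega⟩)
  have hbdd : BddBelow (Set.range R) := by
    refine ⟨b, ?_⟩
    rintro _ ⟨k, rfl⟩
    exact (hb k).trans (haR k k (Finset.mem_Icc.2 ⟨Nat.sub_le k M, le_rfl⟩))
  set r := ⨅ k, R k
  have hR : Tendsto R atTop (𝓝 r) := tendsto_atTop_ciInf hanti hbdd
  have hrR : ∀ k, r ≤ R k := fun k => ciInf_le hbdd k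
  rw [Metric.tendsto_atTop]
  intro ε hε
  obtain ⟨ε', hε', K, hK⟩ := exists_lower_bound_of_nonmonotone_decrease hc hR hdecR hcont M
    (c * ε ^ 2 / 2) (by positivity)
  obtain ⟨K', hK'⟩ := eventually_atTop.1 (hR.eventually_lt_const
    (show r < r + c * ε ^ 2 / 2 by linarith [show 0 < c * ε ^ 2 / 2 by positivity]))
  refine ⟨max K K', fun k hk => ?_⟩
  -- the window that ends at `k + 1 + M` starts at `k + 1` and contains a value `≥ r`
  obtain ⟨l, hl, hlR⟩ := Finset.exists_mem_eq_sup' (hne (k + 1 + M)) a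
  rw [Finset.mem_Icc] at hl
  have h1 := hK (k + 1) (by have := le_max_left K K'; omega) (l - (k + 1)) (by omega) (by
    rw [show k + 1 + (l - (k + 1)) = l by omega, ← hlR]
    linarith [hrR (k + 1 + M)])
  have h2 := hK' k (le_trans (le_max_right _ _) hk)
  have h3 := hdecR k
  rw [Real.dist_eq, sub_zero, abs_of_nonneg (hδ k)]
  refine lt_of_pow_lt_pow_left₀ 2 hε.le ?_
  refine lt_of_mul_lt_mul_left ?_ hc.le
  linarith

/-! ### Descent inequalities -/

lemma le_of_deriv_sub_le {φ φ' : ℝ → ℝ} {c : ℝ} (hφ : ∀ t, HasDerivAt φ (φ' t) t)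
    (hφ' : ∀ t, 0 ≤ t → φ' t - φ' 0 ≤ c * t) : φ 1 ≤ φ 0 + φ' 0 + c / 2 := by
  have hd : ∀ t, HasDerivAt (fun t => φ t - φ' 0 * t - c / 2 * t ^ 2)
      (φ' t - φ' 0 - c * t) t := fun t => by
    have := ((hφ t).sub ((hasDerivAt_id t).const_mul (φ' 0))).sub
      (((hasDerivAt_id t).pow 2).const_mul (c / 2))
    refine this.congr_deriv ?_
    simp
    ring
  have hanti : AntitoneOn (fun t => φ t - φ' 0 * t - c / 2 * t ^ 2) (Set.Icc 0 1) := by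
    refine antitoneOn_of_deriv_nonpos (convex_Icc 0 1)
      (fun t _ => (hd t).continuousAt.continuousWithinAt)
      (fun t _ => (hd t).differentiableAt.differentiableWithinAt) fun t ht => ?_
    rw [interior_Icc] at ht
    rw [(hd t).deriv]
    linarith [hφ' t ht.1.le]
  have := hanti (Set.left_mem_Icc.2 zero_le_one) (Set.right_mem_Icc.2 zero_le_one) zero_le_one
  simp only at this
  linarith

section Descent

variable {E : Type*} [NormedAddCommGroup E] [InnerProductSpace ℝ E] [CompleteSpace E]

lemma abs_sub_inner_gradient_le {f : E → ℝ} (hf : Differentiable ℝ f) {x h : E} {c : ℝ}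
    (hc : ∀ t : ℝ, 0 ≤ t → |⟪gradient f (x + t • h) - gradient f x, h⟫| ≤ c * t) :
    |f (x + h) - f x - ⟪gradient f x, h⟫| ≤ c / 2 := by
  have hd : ∀ t : ℝ, HasDerivAt (fun t : ℝ => f (x + t • h)) ⟪gradient f (x + t • h), h⟫ t := by
    intro t
    have h1 := (hf (x + t • h)).hasGradientAt.hasFDerivAt
    have h2 : HasDerivAt (fun t : ℝ => x + t • h) h t := by
      simpa using ((hasDerivAt_id t).smul_const h).const_add x
    have h3 := h1.comp_hasDerivAt t h2
    rw [InnerProductSpace.toDual_apply_apply] at h3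
    exact h3
  have h1 := le_of_deriv_sub_le hd (c := c) fun t ht => by
    have := (abs_le.1 (hc t ht)).2
    rw [inner_sub_left] at this
    simpa using this
  have h2 := le_of_deriv_sub_le (fun t => (hd t).neg) (c := c) fun t ht => by
    have := (abs_le.1 (hc t ht)).1
    rw [inner_sub_left] at this
    simp only [zero_smul, add_zero]
    linarith
  simp only [one_smul, zero_smul, add_zero, Pi.neg_apply] at h1 h2
  rw [abs_le]
  constructor <;> linarith

lemma abs_sub_inner_gradient_le_of_lipschitz {f : E → ℝ} (hf : Differentiable ℝ f) {K : NNReal}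
    (hK : LipschitzWith K (gradient f)) (x h : E) :
    |f (x + h) - f x - ⟪gradient f x, h⟫| ≤ K / 2 * ‖h‖ ^ 2 := by
  have := abs_sub_inner_gradient_le hf (x := x) (h := h) (c := K * ‖h‖ ^ 2) fun t ht => by
    refine (abs_real_inner_le_norm _ _).trans ?_
    have h1 := hK.dist_le_mul (x + t • h) x
    rw [dist_eq_norm, dist_eq_norm, add_sub_cancel_left, norm_smul, Real.norm_of_nonneg ht] at h1
    calc _ ≤ (K * (t * ‖h‖)) * ‖h‖ := by gcongr
      _ = _ := by ring
  linarith

end Descent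

variable {n : ℕ} {N : Fin n → ℕ}

/-! ### Block vectors -/

@[simp] lemma embed_apply_same (i : Fin n) (s : EuclideanSpace ℝ (Fin (N i))) :
    embed i s i = s := by
  simp [embed]

lemma embed_apply_of_ne {i j : Fin n} (h : j ≠ i) (s : EuclideanSpace ℝ (Fin (N i))) :
    embed i s j = 0 := by
  simp [embed, h]

@[simp] lemma embed_zero (i : Fin n) : embed i (0 : EuclideanSpace ℝ (Fin (N i))) = 0 := by
  ext j : 1
  simp [embed]

lemma sum_embed (w : BlockSpace N) : ∑ i, embed i (w i) = w := by
  ext j : 1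
  rw [WithLp.ofLp_sum, Finset.sum_apply, Finset.sum_eq_single j]
  · exact embed_apply_same j _
  · exact fun i _ hij => embed_apply_of_ne hij.symm _
  · simp

lemma inner_embed (g : BlockSpace N) (i : Fin n) (s : EuclideanSpace ℝ (Fin (N i))) :
    ⟪g, embed i s⟫ = ⟪g i, s⟫ := by
  rw [PiLp.inner_apply, Finset.sum_eq_single i]
  · rw [embed_apply_same]
  · exact fun j _ hj => by rw [embed_apply_of_ne hj, inner_zero_right]
  · simp

lemma norm_sq_eq_sum (w : BlockSpace N) : ‖w‖ ^ 2 = ∑ i, ‖w i‖ ^ 2 := PiLp.norm_sq_eq_of_L2 _ w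

@[simp] lemma norm_embed (i : Fin n) (s : EuclideanSpace ℝ (Fin (N i))) :
    ‖embed i s‖ = ‖s‖ := by
  simp [embed]

lemma norm_apply_le (w : BlockSpace N) (i : Fin n) : ‖w i‖ ≤ ‖w‖ := PiLp.norm_apply_le w i

lemma embed_sub (i : Fin n) (s s' : EuclideanSpace ℝ (Fin (N i))) :
    embed i (s - s') = embed i s - embed i s' := by
  ext j : 1
  rcases eq_or_ne j i with rfl | h
  · simp
  · simp [embed_apply_of_ne h]

lemma isometry_embed (i : Fin n) :
    Isometry (embed i : EuclideanSpace ℝ (Fin (N i)) → BlockSpace N) :=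
  Isometry.of_dist_eq fun s s' => by rw [dist_eq_norm, ← embed_sub, norm_embed, dist_eq_norm]

/-- The two-sided descent inequality along a block; block-coordinate-wise Lipschitz continuity of
the gradient is enough for it. -/
lemma abs_sub_inner_block_gradient_le {f : BlockSpace N → ℝ} {L : Fin n → ℝ}
    (hf : Differentiable ℝ f) (hfL : BlockLipschitzGradient f L) (x : BlockSpace N) (i : Fin n)
    (s : EuclideanSpace ℝ (Fin (N i))) :
    |f (x + embed i s) - f x - ⟪gradient f x i, s⟫| ≤ L i / 2 * ‖s‖ ^ 2 := by
  have := abs_sub_inner_gradient_le hf (x := x) (h := embed i s) (c := L i * ‖s‖ ^ 2)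
    fun t ht => by
      rw [inner_embed]
      refine (abs_real_inner_le_norm _ _).trans ?_
      have h1 := hfL i x (t • embed i s) fun j hj => by
        simp [embed_apply_of_ne hj]
      rw [norm_smul, norm_embed, Real.norm_of_nonneg ht] at h1
      calc _ ≤ (L i * (t * ‖s‖)) * ‖s‖ := by gcongr; exact h1
        _ = _ := by ring
  rw [inner_embed] at this
  linarith

/-- A differentiable function with block-coordinate-wise Lipschitz gradient is continuously
differentiable. Its gradient need not be Lipschitz, but along each block a difference quotient of
`f` approximates the block of the gradient uniformly in the base point. -/
lemma continuous_gradient {f : BlockSpace N → ℝ} {L : Fin n → ℝ} (hf : Differentiable ℝ f)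
    (hL : ∀ i, 0 < L i) (hfL : BlockLipschitzGradient f L) : Continuous (gradient f) := by
  suffices h : ∀ i, Continuous fun x => gradient f x i by
    have : Continuous fun x => WithLp.toLp 2 fun i => gradient f x i :=
      (PiLp.continuous_toLp 2 _).comp (continuous_pi h)
    exact this
  refine fun i => continuous_iff_continuousAt.2 fun z => Metric.tendsto_nhds.2 fun ε hε => ?_
  -- difference quotients with step length `r`
  set r := ε / (4 * L i) with hr
  have hLi := hL i
  have hr0 : 0 < r := by positivity
  have hLr : L i * r = ε / 4 := by rw [hr]; field_simp
  -- continuity of `f` at `z + embed i s`, uniformly over the compact sphere of radius `r`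
  have hcpt : IsCompact (Metric.sphere (0 : EuclideanSpace ℝ (Fin (N i))) r) := isCompact_sphere 0 r
  have hg : Continuous fun q : BlockSpace N × EuclideanSpace ℝ (Fin (N i)) =>
      |(f (q.1 + embed i q.2) - f q.1) - (f (z + embed i q.2) - f z)| := by
    have he := (isometry_embed (N := N) i).continuous
    have := hf.continuous
    fun_prop
  have hev : ∀ᶠ x in 𝓝 z, ∀ s ∈ Metric.sphere (0 : EuclideanSpace ℝ (Fin (N i))) r,
      |(f (x + embed i s) - f x) - (f (z + embed i s) - f z)| < ε / 4 * r := by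
    refine hcpt.eventually_forall_of_forall_eventually fun s _ => ?_
    exact hg.continuousAt.eventually_lt_const (by simp; positivity)
  filter_upwards [hev] with x hx
  rw [dist_eq_norm]
  set u := gradient f x i - gradient f z i with hu
  rcases eq_or_ne u 0 with h0 | h0
  · rw [h0, norm_zero]; exact hε
  have hu0 : 0 < ‖u‖ := norm_pos_iff.2 h0
  set s := (r / ‖u‖) • u with hs
  have hsn : ‖s‖ = r := by
    rw [hs, norm_smul, norm_div, norm_norm, Real.norm_of_nonneg hr0.le]; field_simp
  have h1 := abs_lt.1 (hx s (by simpa using hsn))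
  have h2 := abs_le.1 (abs_sub_inner_block_gradient_le hf hfL x i s)
  have h3 := abs_le.1 (abs_sub_inner_block_gradient_le hf hfL z i s)
  have h4 : ⟪u, s⟫ = r * ‖u‖ := by
    rw [hs, inner_smul_right, real_inner_self_eq_norm_sq]; field_simp
  rw [hsn] at h2 h3
  have h5 : L i / 2 * r ^ 2 = ε / 8 * r := by
    rw [show L i / 2 * r ^ 2 = (L i * r) * r / 2 by ring, hLr]; ring
  rw [hu, inner_sub_left, ← hu] at h4
  rw [h5] at h2 h3
  have : r * ‖u‖ < r * ε := by nlinarith [h1.2, h2.1, h3.2, mul_pos hr0 hε]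
  exact lt_of_mul_lt_mul_left this hr0.le

/-! ### The Clarke subdifferential -/

section Clarke

variable {E : Type*} [NormedAddCommGroup E] [InnerProductSpace ℝ E]

/-- Proximal subgradients are Clarke subgradients: bound the limit superior from below along
difference quotients with base point `x`. -/
lemma mem_clarkeSubdifferential_of_quadratic_minorant {φ : E → EReal} {x ζ : E} {c : ℝ}
    (hφ : LipschitzNear φ x)
    (h : ∀ y, φ y ≠ ⊤ → (φ x).toReal + ⟪ζ, y - x⟫ - c * ‖y - x‖ ^ 2 ≤ (φ y).toReal) :
    ζ ∈ clarkeSubdifferential φ x := by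
  refine ⟨hφ, fun v => ?_⟩
  obtain ⟨U, hU, K, hfin, -⟩ := hφ
  have hlim : Tendsto (fun t : ℝ => ((⟪ζ, v⟫ - c * t * ‖v‖ ^ 2 : ℝ) : EReal)) (𝓝[>] 0)
      (𝓝 ((⟪ζ, v⟫ : ℝ) : EReal)) := by
    refine (continuous_coe_real_ereal.tendsto _).comp ?_
    have : Continuous fun t : ℝ => ⟪ζ, v⟫ - c * t * ‖v‖ ^ 2 := by fun_prop
    simpa using (this.tendsto 0).mono_left (nhdsWithin_le_nhds (s := Set.Ioi 0))
  have hpt : Tendsto (fun t : ℝ => (x, t)) (𝓝[>] 0) (𝓝 x ×ˢ 𝓝[>] 0) :=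
    tendsto_const_nhds.prodMk tendsto_id
  have hxU : Tendsto (fun t : ℝ => x + t • v) (𝓝[>] 0) (𝓝 x) := by
    have : Continuous fun t : ℝ => x + t • v := by fun_prop
    simpa using (this.tendsto 0).mono_left (nhdsWithin_le_nhds (s := Set.Ioi 0))
  calc ((⟪ζ, v⟫ : ℝ) : EReal)
      = limsup (fun t : ℝ => ((⟪ζ, v⟫ - c * t * ‖v‖ ^ 2 : ℝ) : EReal)) (𝓝[>] 0) :=
        hlim.limsup_eq.symm
    _ ≤ limsup ((fun q : E × ℝ =>
          ((((φ (q.1 + q.2 • v)).toReal - (φ q.1).toReal) / q.2 : ℝ) : EReal)) ∘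
            fun t : ℝ => (x, t)) (𝓝[>] 0) := by
        refine limsup_le_limsup ?_
        filter_upwards [hxU.eventually hU, self_mem_nhdsWithin] with t htU (ht : 0 < t)
        have := h (x + t • v) (hfin _ htU).1
        rw [add_sub_cancel_left, inner_smul_right, norm_smul, Real.norm_of_nonneg ht.le] at this
        rw [Function.comp_apply, EReal.coe_le_coe_iff, le_div_iff₀ ht]
        linarith
    _ = limsup (fun q : E × ℝ =>
          ((((φ (q.1 + q.2 • v)).toReal - (φ q.1).toReal) / q.2 : ℝ) : EReal))
            (map (fun t : ℝ => (x, t)) (𝓝[>] 0)) := limsup_comp _ _ _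
    _ ≤ clarkeDeriv φ x v := limsup_le_limsup_of_le hpt

/-- The graph of the Clarke subdifferential is closed, because `clarkeDeriv φ · v` is upper
semicontinuous. -/
lemma mem_clarkeSubdifferential_of_tendsto {φ : E → EReal} {z ζ : E} {y g : ℕ → E}
    (hφ : LipschitzNear φ z) (hy : Tendsto y atTop (𝓝 z)) (hg : Tendsto g atTop (𝓝 ζ))
    (h : ∀ k, g k ∈ clarkeSubdifferential φ (y k)) : ζ ∈ clarkeSubdifferential φ z := by
  refine ⟨hφ, fun v => le_of_forall_gt_imp_ge_of_dense fun c hc => ?_⟩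
  have hev := eventually_lt_of_limsup_lt hc
  obtain ⟨pa, hpa, pb, hpb, hab⟩ := eventually_prod_iff.1 hev
  have hlim : Tendsto (fun k => ((⟪g k, v⟫ : ℝ) : EReal)) atTop (𝓝 ((⟪ζ, v⟫ : ℝ) : EReal)) :=
    (continuous_coe_real_ereal.tendsto _).comp (hg.inner tendsto_const_nhds)
  refine le_of_tendsto hlim ?_
  filter_upwards [hy.eventually (eventually_eventually_nhds.2 hpa)] with k hk
  refine ((h k).2 v).trans (limsup_le_of_le (h := ?_))
  exact eventually_prod_iff.2 ⟨pa, hk, pb, hpb, fun ha _ hb => (hab ha hb).le⟩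

end Clarke

variable {f : BlockSpace N → ℝ}
  {Ψ : (i : Fin n) → EuclideanSpace ℝ (Fin (N i)) → EReal}

/-! ### Finiteness of the objective -/

lemma ereal_sum_ne_bot {ι : Type*} {s : Finset ι} {a : ι → EReal} (h : ∀ i ∈ s, a i ≠ ⊥) :
    ∑ i ∈ s, a i ≠ ⊥ := by
  classical
  induction s using Finset.induction_on with
  | empty => simp
  | insert j s hj ih =>
    rw [Finset.sum_insert hj, EReal.add_ne_bot_iff]
    exact ⟨h j (Finset.mem_insert_self j s), ih fun i hi => h i (Finset.mem_insert_of_mem hi)⟩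

lemma ereal_coe_sum {ι : Type*} (s : Finset ι) (a : ι → ℝ) :
    ((∑ i ∈ s, a i : ℝ) : EReal) = ∑ i ∈ s, (a i : EReal) := by
  classical
  induction s using Finset.induction_on with
  | empty => simp
  | insert j s hj ih => rw [Finset.sum_insert hj, Finset.sum_insert hj, EReal.coe_add, ih]

lemma sep_ne_bot (hΨ : ∀ i y, Ψ i y ≠ ⊥) (x : BlockSpace N) : sep Ψ x ≠ ⊥ :=
  ereal_sum_ne_bot fun i _ => hΨ i _

lemma objective_ne_bot (hΨ : ∀ i y, Ψ i y ≠ ⊥) (x : BlockSpace N) : objective f Ψ x ≠ ⊥ :=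
  EReal.add_ne_bot_iff.2 ⟨EReal.coe_ne_bot _, sep_ne_bot hΨ x⟩

lemma sep_eq_coe (hΨ : ∀ i y, Ψ i y ≠ ⊥) {x : BlockSpace N} (hx : ∀ i, Ψ i (x i) ≠ ⊤) :
    sep Ψ x = ((∑ i, (Ψ i (x i)).toReal : ℝ) : EReal) := by
  rw [ereal_coe_sum, sep]
  exact Finset.sum_congr rfl fun i _ => (EReal.coe_toReal (hx i) (hΨ i _)).symm

lemma sep_ne_top_iff (hΨ : ∀ i y, Ψ i y ≠ ⊥) {x : BlockSpace N} :
    sep Ψ x ≠ ⊤ ↔ ∀ i, Ψ i (x i) ≠ ⊤ := by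
  refine ⟨fun h i hi => h ?_, fun h => by rw [sep_eq_coe hΨ h]; exact EReal.coe_ne_top _⟩
  rw [sep, ← Finset.add_sum_erase _ _ (Finset.mem_univ i), hi]
  exact EReal.top_add_of_ne_bot (ereal_sum_ne_bot fun j _ => hΨ j _)

lemma objective_ne_top_iff (hΨ : ∀ i y, Ψ i y ≠ ⊥) {x : BlockSpace N} :
    objective f Ψ x ≠ ⊤ ↔ ∀ i, Ψ i (x i) ≠ ⊤ := by
  rw [objective, EReal.add_ne_top_iff_ne_top₂ (EReal.coe_ne_bot _) (sep_ne_bot hΨ x),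
    sep_ne_top_iff hΨ]
  simp

lemma objective_eq_coe (hΨ : ∀ i y, Ψ i y ≠ ⊥) {x : BlockSpace N} (hx : ∀ i, Ψ i (x i) ≠ ⊤) :
    objective f Ψ x = ((f x + ∑ i, (Ψ i (x i)).toReal : ℝ) : EReal) := by
  rw [objective, sep_eq_coe hΨ hx, EReal.coe_add]

lemma toReal_objective (hΨ : ∀ i y, Ψ i y ≠ ⊥) {x : BlockSpace N} (hx : ∀ i, Ψ i (x i) ≠ ⊤) :
    (objective f Ψ x).toReal = f x + ∑ i, (Ψ i (x i)).toReal := by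
  rw [objective_eq_coe hΨ hx, EReal.toReal_coe]

lemma ne_top_add_embed {x : BlockSpace N} (hx : ∀ i, Ψ i (x i) ≠ ⊤) {i : Fin n}
    {s : EuclideanSpace ℝ (Fin (N i))} (hs : Ψ i (x i + s) ≠ ⊤) (j : Fin n) :
    Ψ j ((x + embed i s) j) ≠ ⊤ := by
  rcases eq_or_ne j i with rfl | h
  · simpa using hs
  · simpa [embed_apply_of_ne h] using hx j

lemma sum_toReal_add_embed (x : BlockSpace N) (i : Fin n) (s : EuclideanSpace ℝ (Fin (N i))) :
    ∑ j, (Ψ j ((x + embed i s) j)).toReal =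
      ∑ j, (Ψ j (x j)).toReal + ((Ψ i (x i + s)).toReal - (Ψ i (x i)).toReal) := by
  rw [← Finset.add_sum_erase _ _ (Finset.mem_univ i), ← Finset.add_sum_erase _ (fun j =>
    (Ψ j (x j)).toReal) (Finset.mem_univ i), Finset.sum_congr rfl fun j hj => by
      rw [PiLp.add_apply, embed_apply_of_ne (Finset.ne_of_mem_erase hj), add_zero]]
  simp
  ring

lemma lowerSemicontinuous_ereal_sum {ι α : Type*} [TopologicalSpace α] {g : ι → α → EReal}
    (hb : ∀ i y, g i y ≠ ⊥) (hg : ∀ i, LowerSemicontinuous (g i)) (s : Finset ι) :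
    LowerSemicontinuous fun y => ∑ i ∈ s, g i y := by
  classical
  induction s using Finset.induction_on with
  | empty => simpa using lowerSemicontinuous_const
  | insert j s hj ih =>
    simp only [Finset.sum_insert hj]
    exact (hg j).add' ih fun y => EReal.continuousAt_add
      (Or.inr (ereal_sum_ne_bot fun i _ => hb i y)) (Or.inl (hb j y))

lemma lowerSemicontinuous_objective (hf : Continuous f) (hΨ : ∀ i y, Ψ i y ≠ ⊥)
    (hlsc : ∀ i, LowerSemicontinuous (Ψ i)) : LowerSemicontinuous (objective f Ψ) := by
  have h1 : LowerSemicontinuous (sep Ψ) :=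
    lowerSemicontinuous_ereal_sum (g := fun i (x : BlockSpace N) => Ψ i (x i)) (fun i y => hΨ i _)
      (fun i => (hlsc i).comp (PiLp.continuous_apply 2 _ i)) Finset.univ
  exact (continuous_coe_real_ereal.comp hf).lowerSemicontinuous.add' h1 fun x =>
    EReal.continuousAt_add (Or.inr (sep_ne_bot hΨ x)) (Or.inl (EReal.coe_ne_bot _))

/-! ### Local Lipschitz continuity of separable functions -/

lemma LipschitzNear.apply_of_sep (hΨ : ∀ i y, Ψ i y ≠ ⊥) {x : BlockSpace N}
    (h : LipschitzNear (sep Ψ) x) (i : Fin n) : LipschitzNear (Ψ i) (x i) := by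
  obtain ⟨U, hU, K, hfin, hK⟩ := h
  have hx : ∀ j, Ψ j (x j) ≠ ⊤ := (sep_ne_top_iff hΨ).1 (hfin x (mem_of_mem_nhds hU)).1
  set e : EuclideanSpace ℝ (Fin (N i)) → BlockSpace N := fun s => x + embed i (s - x i)
  have hei : Isometry e := (isometry_add_left x).comp
    ((isometry_embed i).comp (IsometryEquiv.subRight (x i)).isometry)
  have he : ∀ s, e s i = s := fun s => by simp [e]
  have hex : e (x i) = x := by simp [e]
  have hmem : e ⁻¹' U ∈ 𝓝 (x i) := hei.continuous.continuousAt.preimage_mem_nhds (by rwa [hex])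
  refine ⟨_, hmem, K, fun s hs => ⟨?_, hΨ i s⟩, ?_⟩
  · have := (sep_ne_top_iff hΨ).1 (hfin _ hs).1 i
    rwa [he] at this
  refine LipschitzOnWith.of_dist_le_mul fun s hs s' hs' => ?_
  have key : ∀ s ∈ e ⁻¹' U, (sep Ψ (e s)).toReal =
      ∑ j, (Ψ j (x j)).toReal + ((Ψ i s).toReal - (Ψ i (x i)).toReal) := fun s hs => by
    rw [sep_eq_coe hΨ ((sep_ne_top_iff hΨ).1 (hfin _ hs).1), EReal.toReal_coe,
      sum_toReal_add_embed, add_sub_cancel]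
  have := hK.dist_le_mul _ hs _ hs'
  rw [hei.dist_eq, key s hs, key s' hs', Real.dist_eq] at this
  rw [Real.dist_eq]
  convert this using 2
  ring

lemma LipschitzNear.sep_of_apply (hΨ : ∀ i y, Ψ i y ≠ ⊥) {x : BlockSpace N}
    (h : ∀ i, LipschitzNear (Ψ i) (x i)) : LipschitzNear (sep Ψ) x := by
  choose U hU K hfin hK using h
  have hmem : (⋂ i, (fun y : BlockSpace N => y i) ⁻¹' U i) ∈ 𝓝 x :=
    Filter.iInter_mem.2 fun i =>
      (PiLp.continuous_apply 2 _ i).continuousAt.preimage_mem_nhds (hU i)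
  have hfin' : ∀ y ∈ ⋂ i, (fun y : BlockSpace N => y i) ⁻¹' U i, ∀ i, Ψ i (y i) ≠ ⊤ :=
    fun y hy i => (hfin i _ (Set.mem_iInter.1 hy i)).1
  refine ⟨_, hmem, ∑ i, K i, fun y hy => ⟨(sep_ne_top_iff hΨ).2 (hfin' y hy), sep_ne_bot hΨ y⟩, ?_⟩
  refine LipschitzOnWith.of_dist_le_mul fun y hy y' hy' => ?_
  rw [sep_eq_coe hΨ (hfin' y hy), sep_eq_coe hΨ (hfin' y' hy'), EReal.toReal_coe,
    EReal.toReal_coe, NNReal.coe_sum, Finset.sum_mul]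
  refine (dist_sum_sum_le _ _ _).trans (Finset.sum_le_sum fun i _ => ?_)
  refine ((hK i).dist_le_mul _ (Set.mem_iInter.1 hy i) _ (Set.mem_iInter.1 hy' i)).trans ?_
  gcongr
  rw [dist_eq_norm, dist_eq_norm, ← PiLp.sub_apply]
  exact norm_apply_le _ i

/-! ### Proximal steps -/

lemma IsProxStep.ne_top {x : BlockSpace N} {i : Fin n} {θ : ℝ}
    {s : EuclideanSpace ℝ (Fin (N i))} (h : IsProxStep f Ψ x i θ s) (hx : Ψ i (x i) ≠ ⊤) :
    Ψ i (x i + s) ≠ ⊤ := fun htop => by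
  have := h 0
  rw [htop, EReal.add_top_of_ne_bot (EReal.coe_ne_bot _), top_le_iff, add_zero] at this
  exact EReal.add_ne_top (EReal.coe_ne_top _) hx this

lemma IsProxStep.le_toReal (hΨ : ∀ i y, Ψ i y ≠ ⊥) {x : BlockSpace N} {i : Fin n} {θ : ℝ}
    {s : EuclideanSpace ℝ (Fin (N i))} (h : IsProxStep f Ψ x i θ s) (hx : Ψ i (x i) ≠ ⊤)
    {s' : EuclideanSpace ℝ (Fin (N i))} (hs' : Ψ i (x i + s') ≠ ⊤) :
    ⟪gradient f x i, s⟫ + θ / 2 * ‖s‖ ^ 2 + (Ψ i (x i + s)).toReal ≤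
      ⟪gradient f x i, s'⟫ + θ / 2 * ‖s'‖ ^ 2 + (Ψ i (x i + s')).toReal := by
  have := h s'
  rwa [← EReal.coe_toReal (h.ne_top hx) (hΨ i _), ← EReal.coe_toReal hs' (hΨ i _),
    ← EReal.coe_add, ← EReal.coe_add, EReal.coe_le_coe_iff] at this

/-- Every proximal step with a sufficiently large parameter passes the acceptance test. -/
lemma IsProxStep.accepts {L : Fin n → ℝ} (hf : Differentiable ℝ f) (hΨ : ∀ i y, Ψ i y ≠ ⊥)
    (hfL : BlockLipschitzGradient f L) {x : BlockSpace N} (hx : objective f Ψ x ≠ ⊤) {R : EReal}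
    (hR : objective f Ψ x ≤ R) {i : Fin n} {σ θ : ℝ} {s : EuclideanSpace ℝ (Fin (N i))}
    (hθ : L i + σ ≤ θ) (h : IsProxStep f Ψ x i θ s) : Accepts f Ψ σ x R (embed i s) := by
  rw [objective_ne_top_iff hΨ] at hx
  refine le_trans ?_ (EReal.sub_le_sub hR le_rfl)
  have hs := h.ne_top (hx i)
  have h0 := h.le_toReal hΨ (hx i) (s' := 0) (by simpa using hx i)
  have h1 := (abs_le.1 (abs_sub_inner_block_gradient_le hf hfL x i s)).2
  rw [objective_eq_coe hΨ (ne_top_add_embed hx hs), objective_eq_coe hΨ hx, ← EReal.coe_sub,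
    EReal.coe_le_coe_iff, sum_toReal_add_embed, norm_embed]
  simp only [inner_zero_right, norm_zero, add_zero] at h0
  nlinarith [sq_nonneg ‖s‖]

/-- The inner loop stops with a parameter that is bounded in terms of the data of the problem,
since it cannot reject a step whose parameter is at least `L i + σ`. -/
lemma IsInnerOutput.exists_isProxStep {L : Fin n → ℝ} (hf : Differentiable ℝ f)
    (hΨ : ∀ i y, Ψ i y ≠ ⊥) (hL : ∀ i, 0 < L i) (hfL : BlockLipschitzGradient f L)
    {η σ θlo θhi : ℝ} (hη : 1 < η) (hθlo : 0 < θlo) {x : BlockSpace N}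
    (hx : objective f Ψ x ≠ ⊤) {R : EReal} (hR : objective f Ψ x ≤ R) {i : Fin n}
    {d : BlockSpace N} (h : IsInnerOutput f Ψ η σ θlo θhi x R i d) :
    ∃ θ s, 0 < θ ∧ θ ≤ max θhi (η * (∑ j, L j + σ)) ∧ IsProxStep f Ψ x i θ s ∧ d = embed i s ∧
      Accepts f Ψ σ x R d := by
  obtain ⟨θ0, hθ0, j, s, hprox, hrej, hacc, rfl⟩ := h
  have hθ0' : 0 < θ0 := hθlo.trans_le hθ0.1
  refine ⟨θ0 * η ^ j, s j, by positivity, ?_, hprox j le_rfl, rfl, hacc⟩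
  rcases j with _ | j
  · simpa using Or.inl hθ0.2
  · refine le_max_of_le_right ?_
    have h1 : θ0 * η ^ j < L i + σ := by
      by_contra! hle
      exact hrej j (Nat.lt_succ_self j) ((hprox j (Nat.le_succ j)).accepts hf hΨ hfL hx hR hle)
    have h2 : L i ≤ ∑ j, L j := Finset.single_le_sum (fun j _ => (hL j).le) (Finset.mem_univ i)
    calc θ0 * η ^ (j + 1) = η * (θ0 * η ^ j) := by ring
      _ ≤ η * (∑ j, L j + σ) := by gcongr; linarith

section FullStep

variable {x w : BlockSpace N} {θ : Fin n → ℝ}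

lemma ne_top_add_of_isProxStep (hΨ : ∀ i y, Ψ i y ≠ ⊥) (hx : objective f Ψ x ≠ ⊤)
    (h : ∀ i, IsProxStep f Ψ x i (θ i) (w i)) (i : Fin n) : Ψ i ((x + w) i) ≠ ⊤ :=
  (h i).ne_top ((objective_ne_top_iff hΨ).1 hx i)

/-- A full proximal step increases the objective at most quadratically. -/
lemma toReal_objective_add_le (hf : Differentiable ℝ f) {K : NNReal}
    (hK : LipschitzWith K (gradient f)) (hΨ : ∀ i y, Ψ i y ≠ ⊥) (hx : objective f Ψ x ≠ ⊤)
    (hθ : ∀ i, 0 < θ i) (h : ∀ i, IsProxStep f Ψ x i (θ i) (w i)) :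
    (objective f Ψ (x + w)).toReal ≤ (objective f Ψ x).toReal + K / 2 * ‖w‖ ^ 2 := by
  have hx' := (objective_ne_top_iff hΨ).1 hx
  rw [toReal_objective hΨ (ne_top_add_of_isProxStep hΨ hx h), toReal_objective hΨ hx']
  have h1 := (abs_le.1 (abs_sub_inner_gradient_le_of_lipschitz hf hK x w)).2
  have h2 : ∑ i, (⟪gradient f x i, w i⟫ + (Ψ i ((x + w) i)).toReal) ≤ ∑ i, (Ψ i (x i)).toReal := by
    refine Finset.sum_le_sum fun i _ => ?_
    have h0 := (h i).le_toReal hΨ (hx' i) (s' := 0) (by simpa using hx' i)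
    simp only [inner_zero_right, norm_zero, add_zero] at h0
    have := mul_nonneg (hθ i).le (sq_nonneg ‖w i‖)
    rw [PiLp.add_apply]
    linarith
  rw [Finset.sum_add_distrib, ← PiLp.inner_apply] at h2
  linarith

/-- The optimality conditions of the proximal subproblems: the end point of a full proximal step
minimizes the sum of `sep Ψ` and a quadratic function, whose gradient there is `-ζ`. -/
lemma exists_mem_clarkeSubdifferential (hΨ : ∀ i y, Ψ i y ≠ ⊥) (hx : objective f Ψ x ≠ ⊤)
    (hlip : LipschitzNear (sep Ψ) (x + w)) {C : ℝ} (hθ : ∀ i, 0 < θ i) (hθC : ∀ i, θ i ≤ C)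
    (hC : 0 ≤ C) (h : ∀ i, IsProxStep f Ψ x i (θ i) (w i)) :
    ∃ ζ ∈ clarkeSubdifferential (sep Ψ) (x + w), ‖gradient f x + ζ‖ ≤ C * ‖w‖ := by
  have hx' := (objective_ne_top_iff hΨ).1 hx
  have hxw := ne_top_add_of_isProxStep hΨ hx h
  refine ⟨WithLp.toLp 2 fun i => -gradient f x i - θ i • w i, ?_, ?_⟩
  · refine mem_clarkeSubdifferential_of_quadratic_minorant (c := C / 2) hlip fun y hy => ?_
    rw [sep_ne_top_iff hΨ] at hy
    rw [sep_eq_coe hΨ hxw, sep_eq_coe hΨ hy, EReal.toReal_coe, EReal.toReal_coe, norm_sq_eq_sum,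
      PiLp.inner_apply, Finset.mul_sum, ← Finset.sum_add_distrib, ← Finset.sum_sub_distrib]
    refine Finset.sum_le_sum fun i _ => ?_
    have h1 := (h i).le_toReal hΨ (hx' i) (s' := y i - x i) (by simpa using hy i)
    set v := (y - (x + w)) i with hv
    have hyx : y i - x i = w i + v := by
      rw [hv, PiLp.sub_apply, PiLp.add_apply]; abel
    rw [hyx, norm_add_sq_real, inner_add_right, ← hyx, add_sub_cancel] at h1
    simp only [PiLp.add_apply, inner_sub_left, inner_neg_left, inner_smul_left, RCLike.conj_to_real]
    nlinarith [mul_le_mul_of_nonneg_right (hθC i) (sq_nonneg ‖v‖)]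
  · refine le_of_sq_le_sq ?_ (by positivity)
    rw [mul_pow, norm_sq_eq_sum, norm_sq_eq_sum, Finset.mul_sum]
    refine Finset.sum_le_sum fun i _ => ?_
    rw [← mul_pow]
    have : (gradient f x + WithLp.toLp 2 fun i => -gradient f x i - θ i • w i) i =
        -(θ i • w i) := by
      simp
      abel
    rw [this, norm_neg, norm_smul, Real.norm_of_nonneg (hθ i).le]
    have := hθ i
    gcongr
    exact hθC i

end FullStep

/-! ### Deterministic properties of a run -/

lemma ereal_sub_coe_le {a : EReal} {c : ℝ} (hc : 0 ≤ c) : a - (c : EReal) ≤ a := by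
  simpa using EReal.sub_le_sub (le_refl a) (EReal.coe_nonneg.2 hc)

/-- A run of the method for a problem with block-coordinate-wise Lipschitz gradient, whose
objective attains its minimum at `xs` and is finite at `x0`, and whose nonsmooth part is locally
Lipschitz continuous in the level set of `x0`. -/
structure AdmissibleRun (f : BlockSpace N → ℝ)
    (Ψ : (i : Fin n) → EuclideanSpace ℝ (Fin (N i)) → EReal) (L : Fin n → ℝ)
    (η σ θlo θhi : ℝ) (M : ℕ) (x0 xs : BlockSpace N) (x : ℕ → (ℕ → Fin n) → BlockSpace N)
    (d : ℕ → (ℕ → Fin n) → Fin n → BlockSpace N) : Prop extends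
    IsRun f Ψ η σ θlo θhi M x0 x d where
  differentiable : Differentiable ℝ f
  ne_bot : ∀ i y, Ψ i y ≠ ⊥
  pos : ∀ i, 0 < L i
  blockLipschitz : BlockLipschitzGradient f L
  isMin : ∀ y, objective f Ψ xs ≤ objective f Ψ y
  ne_top : objective f Ψ x0 ≠ ⊤
  one_lt_η : 1 < η
  σ_pos : 0 < σ
  θlo_pos : 0 < θlo
  θlo_le : θlo ≤ θhi
  uniformContinuousOn : UniformContinuousOn (fun y => (objective f Ψ y).toReal) (levelSet f Ψ x0)
  lipschitzNear : ∀ y ∈ levelSet f Ψ x0, LipschitzNear (sep Ψ) y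

namespace AdmissibleRun

variable {L : Fin n → ℝ} {η σ θlo θhi : ℝ} {M : ℕ} {x0 xs : BlockSpace N}
  {x : ℕ → (ℕ → Fin n) → BlockSpace N} {d : ℕ → (ℕ → Fin n) → Fin n → BlockSpace N}

lemma exists_objective_add_le (h : AdmissibleRun f Ψ L η σ θlo θhi M x0 xs x d) (k : ℕ)
    (ξ : ℕ → Fin n) (i : Fin n) : ∃ l ∈ Finset.Icc (k - M) k,
      objective f Ψ (x k ξ + d k ξ i) ≤
        objective f Ψ (x l ξ) - ((σ / 2 * ‖d k ξ i‖ ^ 2 : ℝ) : EReal) := by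
  obtain ⟨θ0, -, j, s, -, -, hacc, hd⟩ := h.inner k ξ i
  obtain ⟨l, hl, hmax⟩ := Finset.exists_max_image (Finset.Icc (k - M) k)
    (fun j => objective f Ψ (x j ξ)) (Finset.nonempty_Icc.2 (Nat.sub_le k M))
  refine ⟨l, hl, ?_⟩
  rw [hd]
  exact hacc.trans (EReal.sub_le_sub (iSup₂_le fun j hj => hmax j hj) le_rfl)

lemma mem_levelSet (h : AdmissibleRun f Ψ L η σ θlo θhi M x0 xs x d) (k : ℕ) (ξ : ℕ → Fin n) :
    x k ξ ∈ levelSet f Ψ x0 := by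
  have hσ := h.σ_pos
  induction k using Nat.strong_induction_on with
  | _ k ih =>
    rcases k with _ | k
    · rw [h.init ξ]
      exact le_refl (objective f Ψ x0)
    · obtain ⟨l, hl, hle⟩ := h.exists_objective_add_le k ξ (ξ k)
      rw [Finset.mem_Icc] at hl
      rw [h.update]
      exact (hle.trans (ereal_sub_coe_le (by positivity))).trans (ih l (by omega))

lemma add_mem_levelSet (h : AdmissibleRun f Ψ L η σ θlo θhi M x0 xs x d) (k : ℕ) (ξ : ℕ → Fin n)
    (i : Fin n) : x k ξ + d k ξ i ∈ levelSet f Ψ x0 := by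
  have hσ := h.σ_pos
  obtain ⟨l, -, hle⟩ := h.exists_objective_add_le k ξ i
  exact (hle.trans (ereal_sub_coe_le (by positivity))).trans (h.mem_levelSet l ξ)

lemma ne_top_of_mem_levelSet (h : AdmissibleRun f Ψ L η σ θlo θhi M x0 xs x d) {y : BlockSpace N}
    (hy : y ∈ levelSet f Ψ x0) : objective f Ψ y ≠ ⊤ :=
  ne_top_of_le_ne_top h.ne_top hy

lemma coe_toReal_objective (h : AdmissibleRun f Ψ L η σ θlo θhi M x0 xs x d) {y : BlockSpace N}
    (hy : objective f Ψ y ≠ ⊤) : ((objective f Ψ y).toReal : EReal) = objective f Ψ y :=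
  EReal.coe_toReal hy (objective_ne_bot h.ne_bot y)

lemma toReal_le_of_mem_levelSet (h : AdmissibleRun f Ψ L η σ θlo θhi M x0 xs x d)
    {y : BlockSpace N} (hy : y ∈ levelSet f Ψ x0) :
    (objective f Ψ y).toReal ≤ (objective f Ψ x0).toReal :=
  EReal.toReal_le_toReal hy (objective_ne_bot h.ne_bot y) h.ne_top

lemma toReal_min_le (h : AdmissibleRun f Ψ L η σ θlo θhi M x0 xs x d) {y : BlockSpace N}
    (hy : objective f Ψ y ≠ ⊤) : (objective f Ψ xs).toReal ≤ (objective f Ψ y).toReal :=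
  EReal.toReal_le_toReal (h.isMin y) (objective_ne_bot h.ne_bot xs) hy

lemma exists_toReal_add_le (h : AdmissibleRun f Ψ L η σ θlo θhi M x0 xs x d) (k : ℕ)
    (ξ : ℕ → Fin n) (i : Fin n) : ∃ l ∈ Finset.Icc (k - M) k,
      (objective f Ψ (x k ξ + d k ξ i)).toReal ≤
        (objective f Ψ (x l ξ)).toReal - σ / 2 * ‖d k ξ i‖ ^ 2 := by
  obtain ⟨l, hl, hle⟩ := h.exists_objective_add_le k ξ i
  refine ⟨l, hl, ?_⟩
  rwa [← h.coe_toReal_objective (h.ne_top_of_mem_levelSet (h.add_mem_levelSet k ξ i)),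
    ← h.coe_toReal_objective (h.ne_top_of_mem_levelSet (h.mem_levelSet l ξ)),
    ← EReal.coe_sub, EReal.coe_le_coe_iff] at hle

lemma norm_sq_le (h : AdmissibleRun f Ψ L η σ θlo θhi M x0 xs x d) (k : ℕ) (ξ : ℕ → Fin n)
    (i : Fin n) : σ / 2 * ‖d k ξ i‖ ^ 2 ≤
      (objective f Ψ x0).toReal - (objective f Ψ xs).toReal := by
  obtain ⟨l, -, hle⟩ := h.exists_toReal_add_le k ξ i
  have h1 := h.toReal_le_of_mem_levelSet (h.mem_levelSet l ξ)
  have h2 := h.toReal_min_le (h.ne_top_of_mem_levelSet (h.add_mem_levelSet k ξ i))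
  linarith

/-- For every realization of the block indices, the steps that the method takes vanish. -/
lemma tendsto_norm_step (h : AdmissibleRun f Ψ L η σ θlo θhi M x0 xs x d) (ξ : ℕ → Fin n) :
    Tendsto (fun k => ‖d k ξ (ξ k)‖) atTop (𝓝 0) := by
  refine tendsto_zero_of_nonmonotone_decrease (M := M)
    (a := fun k => (objective f Ψ (x k ξ)).toReal)
    (half_pos h.σ_pos) (fun k => norm_nonneg _)
    (fun k => h.toReal_min_le (h.ne_top_of_mem_levelSet (h.mem_levelSet k ξ))) (fun k => ?_)
    fun ε hε => ?_
  · simp only [h.update]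
    exact h.exists_toReal_add_le k ξ (ξ k)
  · obtain ⟨δ, hδ, hu⟩ := Metric.uniformContinuousOn_iff.1 h.uniformContinuousOn ε hε
    refine ⟨δ, hδ, fun k hk => ?_⟩
    have := hu _ (h.mem_levelSet (k + 1) ξ) _ (h.mem_levelSet k ξ)
      (by rwa [h.update, dist_eq_norm, add_sub_cancel_left])
    rwa [Real.dist_eq] at this

lemma exists_isProxStep (h : AdmissibleRun f Ψ L η σ θlo θhi M x0 xs x d) (k : ℕ)
    (ξ : ℕ → Fin n) : ∃ θ : Fin n → ℝ, (∀ i, 0 < θ i) ∧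
      (∀ i, θ i ≤ max θhi (η * (∑ j, L j + σ))) ∧
      (∀ i, IsProxStep f Ψ (x k ξ) i (θ i) ((∑ j, d k ξ j) i)) ∧
      ∀ i, d k ξ i = embed i ((∑ j, d k ξ j) i) := by
  have hin := fun i => (h.inner k ξ i).exists_isProxStep h.differentiable h.ne_bot h.pos
    h.blockLipschitz h.one_lt_η h.θlo_pos (h.ne_top_of_mem_levelSet (h.mem_levelSet k ξ))
    (le_iSup₂ (f := fun j (_ : j ∈ Finset.Icc (k - M) k) => objective f Ψ (x j ξ)) k
      (Finset.mem_Icc.2 ⟨Nat.sub_le k M, le_rfl⟩))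
  choose θ s hθ hθC hprox hd _ using hin
  have hs : ∀ i, (∑ j, d k ξ j) i = s i := fun i => by
    rw [Finset.sum_congr rfl fun j _ => hd j]
    exact congrArg (fun v : BlockSpace N => v i) (sum_embed (WithLp.toLp 2 s))
  exact ⟨θ, hθ, hθC, fun i => by rw [hs]; exact hprox i, fun i => by rw [hs]; exact hd i⟩

lemma ne_top_add_sum (h : AdmissibleRun f Ψ L η σ θlo θhi M x0 xs x d) (k : ℕ) (ξ : ℕ → Fin n) :
    objective f Ψ (x k ξ + ∑ i, d k ξ i) ≠ ⊤ := by
  obtain ⟨θ, -, -, hprox, -⟩ := h.exists_isProxStep k ξ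
  exact (objective_ne_top_iff h.ne_bot).2
    (ne_top_add_of_isProxStep h.ne_bot (h.ne_top_of_mem_levelSet (h.mem_levelSet k ξ)) hprox)

/-- The full step may leave the level set, but each of its blocks is also reached by a single
block step, which stays there; this suffices for a separable function. -/
lemma lipschitzNear_add_sum (h : AdmissibleRun f Ψ L η σ θlo θhi M x0 xs x d) (k : ℕ)
    (ξ : ℕ → Fin n) : LipschitzNear (sep Ψ) (x k ξ + ∑ i, d k ξ i) := by
  obtain ⟨θ, -, -, -, hd⟩ := h.exists_isProxStep k ξ
  refine LipschitzNear.sep_of_apply h.ne_bot fun i => ?_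
  have := (h.lipschitzNear _ (h.add_mem_levelSet k ξ i)).apply_of_sep h.ne_bot i
  rw [hd i] at this
  simpa using this

lemma exists_mem_clarkeSubdifferential (h : AdmissibleRun f Ψ L η σ θlo θhi M x0 xs x d) (k : ℕ)
    (ξ : ℕ → Fin n) : ∃ ζ ∈ clarkeSubdifferential (sep Ψ) (x k ξ + ∑ i, d k ξ i),
      ‖gradient f (x k ξ) + ζ‖ ≤ max θhi (η * (∑ j, L j + σ)) * ‖∑ i, d k ξ i‖ := by
  obtain ⟨θ, hθ, hθC, hprox, -⟩ := h.exists_isProxStep k ξ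
  exact RNBPG.exists_mem_clarkeSubdifferential h.ne_bot
    (h.ne_top_of_mem_levelSet (h.mem_levelSet k ξ)) (h.lipschitzNear_add_sum k ξ) hθ hθC
    (le_max_of_le_left (h.θlo_pos.le.trans h.θlo_le)) hprox

lemma infEDist_le (h : AdmissibleRun f Ψ L η σ θlo θhi M x0 xs x d) {K : NNReal}
    (hK : LipschitzWith K (gradient f)) (k : ℕ) (ξ : ℕ → Fin n) :
    Metric.infEDist (-gradient f (x k ξ + ∑ i, d k ξ i))
        (clarkeSubdifferential (sep Ψ) (x k ξ + ∑ i, d k ξ i)) ≤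
      ENNReal.ofReal ((max θhi (η * (∑ j, L j + σ)) + K) * ‖∑ i, d k ξ i‖) := by
  obtain ⟨ζ, hζ, hle⟩ := h.exists_mem_clarkeSubdifferential k ξ
  refine (Metric.infEDist_le_edist_of_mem hζ).trans ?_
  rw [edist_dist]
  refine ENNReal.ofReal_le_ofReal ?_
  have h1 := hK.dist_le_mul (x k ξ) (x k ξ + ∑ i, d k ξ i)
  rw [dist_comm (x k ξ), dist_eq_norm (x k ξ + _), add_sub_cancel_left, dist_eq_norm] at h1
  rw [dist_eq_norm, ← norm_neg, show -(-gradient f (x k ξ + ∑ i, d k ξ i) - ζ) =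
    (gradient f (x k ξ) + ζ) - (gradient f (x k ξ) - gradient f (x k ξ + ∑ i, d k ξ i)) by abel]
  linarith [norm_sub_le (gradient f (x k ξ) + ζ)
    (gradient f (x k ξ) - gradient f (x k ξ + ∑ i, d k ξ i))]

lemma exists_norm_sum_le (h : AdmissibleRun f Ψ L η σ θlo θhi M x0 xs x d) :
    ∃ B, ∀ k ξ, ‖∑ i, d k ξ i‖ ≤ B := by
  refine ⟨∑ _i : Fin n, Real.sqrt (2 / σ *
    ((objective f Ψ x0).toReal - (objective f Ψ xs).toReal)), fun k ξ =>
      (norm_sum_le _ _).trans (Finset.sum_le_sum fun i _ => Real.le_sqrt_of_sq_le ?_)⟩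
  have h1 := h.norm_sq_le k ξ i
  have hσ := h.σ_pos
  calc ‖d k ξ i‖ ^ 2 = 2 / σ * (σ / 2 * ‖d k ξ i‖ ^ 2) := by field_simp
    _ ≤ _ := by gcongr

lemma toReal_add_sum_le (h : AdmissibleRun f Ψ L η σ θlo θhi M x0 xs x d) {K : NNReal}
    (hK : LipschitzWith K (gradient f)) (k : ℕ) (ξ : ℕ → Fin n) :
    (objective f Ψ (x k ξ + ∑ i, d k ξ i)).toReal ≤
      (objective f Ψ x0).toReal + K / 2 * ‖∑ i, d k ξ i‖ ^ 2 := by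
  obtain ⟨θ, hθ, -, hprox, -⟩ := h.exists_isProxStep k ξ
  have h1 := toReal_objective_add_le h.differentiable hK h.ne_bot
    (h.ne_top_of_mem_levelSet (h.mem_levelSet k ξ)) hθ hprox
  have h2 := h.toReal_le_of_mem_levelSet (h.mem_levelSet k ξ)
  linarith

/-- Once the full step is short, its end point lies in the enlarged level set, whatever the
Lipschitz constant of the gradient; there the objective is uniformly continuous. If `x0` is a
minimizer, the enlarged level set is no larger than the level set, but then all steps vanish. -/
lemma exists_abs_sub_lt (h : AdmissibleRun f Ψ L η σ θlo θhi M x0 xs x d) {K : NNReal}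
    (hK : LipschitzWith K (gradient f))
    (hS : UniformContinuousOn (fun y => (objective f Ψ y).toReal)
      (enlargedLevelSet f Ψ L σ θlo x0)) {ε : ℝ} (hε : 0 < ε) :
    ∃ δ > 0, ∀ k ξ, ‖∑ i, d k ξ i‖ < δ → |(objective f Ψ (x k ξ)).toReal -
      (objective f Ψ (x k ξ + ∑ i, d k ξ i)).toReal| < ε := by
  have hinf : ⨅ y, objective f Ψ y = objective f Ψ xs :=
    le_antisymm (iInf_le _ xs) (le_iInf h.isMin)
  have hσ := h.σ_pos
  have hgap : (objective f Ψ xs).toReal ≤ (objective f Ψ x0).toReal := h.toReal_min_le h.ne_top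
  rcases eq_or_lt_of_le hgap with heq | hlt
  · refine ⟨1, one_pos, fun k ξ _ => ?_⟩
    have hd : ∀ i, d k ξ i = 0 := fun i => by
      have h1 := h.norm_sq_le k ξ i
      rw [heq, sub_self] at h1
      have h2 : ‖d k ξ i‖ ^ 2 ≤ 0 := by
        by_contra! h3
        have : 0 < σ / 2 * ‖d k ξ i‖ ^ 2 := by positivity
        linarith
      exact norm_eq_zero.1 (pow_eq_zero_iff two_ne_zero |>.1 (le_antisymm h2 (sq_nonneg _)))
    simpa [hd] using hε
  obtain ⟨δ, hδ, hu⟩ := Metric.uniformContinuousOn_iff.1 hS ε hε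
  set g := (objective f Ψ x0).toReal - (objective f Ψ xs).toReal with hg
  have hg0 : 0 < g := sub_pos.2 hlt
  have hmax : g ≤ max ((n : ℝ) / σ * |∑ i, L i - θlo|) 1 * g :=
    le_mul_of_one_le_left hg0.le (le_max_right _ _)
  have hmem : ∀ y, objective f Ψ y ≠ ⊤ →
      (objective f Ψ y).toReal ≤ (objective f Ψ x0).toReal + g →
      y ∈ enlargedLevelSet f Ψ L σ θlo x0 := fun y hy hle => by
    change objective f Ψ y ≤ _
    rw [hinf, ← h.coe_toReal_objective hy, EReal.coe_le_coe_iff]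
    linarith
  refine ⟨min δ (min 1 (2 * g / (K + 1))), by positivity, fun k ξ hd => ?_⟩
  rw [lt_min_iff, lt_min_iff] at hd
  obtain ⟨hd1, hd2, hd3⟩ := hd
  rw [← Real.dist_eq]
  have hx := h.mem_levelSet k ξ
  refine hu _ (hmem _ (h.ne_top_of_mem_levelSet hx) ?_) _ (hmem _ (h.ne_top_add_sum k ξ) ?_) ?_
  · linarith [h.toReal_le_of_mem_levelSet hx]
  · refine (h.toReal_add_sum_le hK k ξ).trans (add_le_add_right ?_ _)
    rw [lt_div_iff₀ (by positivity)] at hd3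
    nlinarith [norm_nonneg (∑ i, d k ξ i), K.coe_nonneg, mul_nonneg K.coe_nonneg
      (mul_nonneg (norm_nonneg (∑ i, d k ξ i)) (sub_nonneg.2 hd2.le))]
  · rwa [dist_comm, dist_eq_norm, add_sub_cancel_left]

/-- Along realizations for which the full steps vanish, the optimality conditions of the proximal
subproblems pass to the limit. -/
lemma isStationary_of_mapClusterPt (h : AdmissibleRun f Ψ L η σ θlo θhi M x0 xs x d)
    (hlsc : ∀ i, LowerSemicontinuous (Ψ i)) {ξ : ℕ → Fin n}
    (hξ : Tendsto (fun k => ∑ i, d k ξ i) atTop (𝓝 0)) {z : BlockSpace N}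
    (hz : MapClusterPt z atTop fun k => x k ξ) : IsStationary f Ψ z := by
  obtain ⟨ψ, hψ, hlim⟩ := hz.tendsto_subseq
  have hzmem : z ∈ levelSet f Ψ x0 :=
    ((lowerSemicontinuous_objective h.differentiable.continuous h.ne_bot hlsc).isClosed_preimage
      (objective f Ψ x0)).mem_of_tendsto hlim (Eventually.of_forall fun k => h.mem_levelSet _ ξ)
  have hd : Tendsto (fun k => ∑ i, d (ψ k) ξ i) atTop (𝓝 0) := hξ.comp hψ.tendsto_atTop
  choose ζ hζ hle using fun k => h.exists_mem_clarkeSubdifferential (ψ k) ξ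
  have hgrad : Tendsto (fun k => gradient f (x (ψ k) ξ)) atTop (𝓝 (gradient f z)) :=
    ((continuous_gradient h.differentiable h.pos h.blockLipschitz).tendsto z).comp hlim
  have hzero : Tendsto (fun k => gradient f (x (ψ k) ξ) + ζ k) atTop (𝓝 0) :=
    squeeze_zero_norm hle (by simpa using hd.norm.const_mul _)
  refine mem_clarkeSubdifferential_of_tendsto (h.lipschitzNear z hzmem)
    (y := fun k => x (ψ k) ξ + ∑ i, d (ψ k) ξ i) (g := ζ) ?_ ?_ hζ
  · simpa using hlim.add hd
  · simpa using hzero.sub hgrad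

lemma iterate_eq (h : AdmissibleRun f Ψ L η σ θlo θhi M x0 xs x d) (k : ℕ) {ξ ξ' : ℕ → Fin n}
    (hξ : ∀ t < k, ξ t = ξ' t) : x k ξ = x k ξ' := by
  induction k with
  | zero => rw [h.init, h.init]
  | succ k ih =>
    rw [h.update, h.update, ih fun t ht => hξ t (ht.trans (Nat.lt_succ_self k)),
      h.nonanticipating k ξ ξ' fun t ht => hξ t (ht.trans (Nat.lt_succ_self k)),
      hξ k (Nat.lt_succ_self k)]

end AdmissibleRun

/-! ### Nonanticipating events and independent indices -/

section Probability

variable {Ω : Type*} [mΩ : MeasurableSpace Ω]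

/-- The filtration whose `k`-th σ-algebra is generated by the indices `I t` with `t < k`. -/
def pastFiltration (I : ℕ → Ω → Fin n) (hI : ∀ k, Measurable (I k)) : Filtration ℕ mΩ where
  seq k := ⨆ t ∈ Set.Iio k, MeasurableSpace.comap (I t) inferInstance
  mono' _ _ hkl := biSup_mono fun _ ht => lt_of_lt_of_le ht hkl
  le' _ := iSup₂_le fun t _ => (hI t).comap_le

lemma measurable_pastFiltration (I : ℕ → Ω → Fin n) (hI : ∀ k, Measurable (I k)) {k t : ℕ}
    (ht : t < k) : Measurable[pastFiltration I hI k] (I t) :=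
  Measurable.of_comap_le (le_iSup₂_of_le t ht le_rfl)

/-- A function of the first `k` indices takes finitely many values and is measurable, for any
σ-algebra on its codomain. -/
lemma measurable_of_nonanticipating {β : Type*} [MeasurableSpace β] (I : ℕ → Ω → Fin n)
    (hI : ∀ k, Measurable (I k)) {G : (ℕ → Fin n) → β} {k : ℕ}
    (hG : ∀ ξ ξ', (∀ t < k, ξ t = ξ' t) → G ξ = G ξ') (i₀ : Fin n) :
    Measurable[pastFiltration I hI k] fun ω => G fun t => I t ω := by
  set G' : (Fin k → Fin n) → β := fun v => G fun t => if ht : t < k then v ⟨t, ht⟩ else i₀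
  have h1 : Measurable[pastFiltration I hI k] fun ω (t : Fin k) => I t ω :=
    @measurable_pi_lambda _ _ _ (pastFiltration I hI k) _ _
      fun t => measurable_pastFiltration I hI t.2
  have h2 : Measurable G' := Measurable.of_discrete
  have h3 : (fun ω => G fun t => I t ω) = fun ω => G' fun t : Fin k => I t ω := by
    funext ω
    exact hG _ _ fun t ht => by simp [ht]
  rw [h3]
  exact h2.comp h1

/-- If the nonanticipating events `A k` and the events `I k = i` happen together only finitely
often, then almost surely `A k` happens only finitely often: by Lévy's extension of the
Borel–Cantelli lemma, since the conditional probability of `I k = i` given the past is a positive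
constant. -/
lemma ae_eventually_notMem (P : Measure Ω) [IsProbabilityMeasure P] {I : ℕ → Ω → Fin n}
    (hI : ∀ k, Measurable (I k)) (hind : iIndepFun I P) {i : Fin n} {q : ℝ} (hq : 0 < q)
    (hlaw : ∀ k, P {ω | I k ω = i} = ENNReal.ofReal q) {A : ℕ → Set (ℕ → Fin n)}
    (hA : ∀ k ξ ξ', (∀ t < k, ξ t = ξ' t) → (ξ ∈ A k ↔ ξ' ∈ A k))
    (hfin : ∀ ξ, ∀ᶠ k in atTop, ¬(ξ ∈ A k ∧ ξ k = i)) :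
    ∀ᵐ ω ∂P, ∀ᶠ k in atTop, (fun t => I t ω) ∉ A k := by
  set ℱ := pastFiltration I hI
  set A' : ℕ → Set Ω := fun k => {ω | (fun t => I t ω) ∈ A k} with hA'
  set B : ℕ → Set Ω := fun k => {ω | I k ω = i} with hB
  have hA'm : ∀ k, MeasurableSet[ℱ k] (A' k) := fun k =>
    @measurableSet_setOfPred _ (ℱ k) _ |>.2 (measurable_of_nonanticipating I hI
      (G := fun ξ => ξ ∈ A k) (fun ξ ξ' hξ => propext (hA k ξ ξ' hξ)) i)
  have hBm : ∀ k, MeasurableSet[MeasurableSpace.comap (I k) inferInstance] (B k) := fun k =>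
    ⟨{i}, measurableSet_singleton i, rfl⟩
  have hBm' : ∀ k, MeasurableSet (B k) := fun k => (hI k).comap_le _ (hBm k)
  -- shifted by one, so that the `k`-th event is known at time `k`
  set s : ℕ → Set Ω := fun k => {ω | 1 ≤ k} ∩ (A' (k - 1) ∩ B (k - 1)) with hs
  have hsm : ∀ k, MeasurableSet[ℱ k] (s k) := fun k => by
    rcases k with _ | k
    · simp [hs]
    · have h1 : MeasurableSet[ℱ (k + 1)] (A' k) := ℱ.mono (Nat.le_succ k) _ (hA'm k)
      have h2 : MeasurableSet[ℱ (k + 1)] (B k) :=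
        (measurable_pastFiltration I hI (Nat.lt_succ_self k)).comap_le _ (hBm k)
      simpa [hs] using h1.inter h2
  have hcond : ∀ k, P[(s (k + 1)).indicator (1 : Ω → ℝ) | ℱ k] =ᵐ[P]
      (A' k).indicator fun _ => q := fun k => by
    have h1 : (s (k + 1)).indicator (1 : Ω → ℝ) = (A' k).indicator ((B k).indicator 1) := by
      simp [hs, Set.indicator_indicator]
    have hind' : Indep (MeasurableSpace.comap (I k) inferInstance) (ℱ k) P := by
      have := indep_iSup_of_disjoint (fun t => (hI t).comap_le) hind
        (S := {k}) (T := Set.Iio k) (by simp)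
      rwa [iSup_singleton] at this
    have h2 := condExp_indep_eq (μ := P) (f := (B k).indicator (1 : Ω → ℝ)) (hI k).comap_le
      (ℱ.le k) (stronglyMeasurable_one.indicator (hBm k)) hind'
    have h3 : ∫ ω, (B k).indicator (1 : Ω → ℝ) ω ∂P = q := by
      rw [integral_indicator_one (hBm' k), measureReal_def, hlaw k, ENNReal.toReal_ofReal hq.le]
    rw [h1]
    refine (condExp_indicator ((integrable_const (1 : ℝ)).indicator (hBm' k)) (hA'm k)).trans ?_
    rw [h3] at h2
    filter_upwards [h2] with ω hω
    by_cases hmem : ω ∈ A' k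
    · rw [Set.indicator_of_mem hmem, Set.indicator_of_mem hmem]
      exact hω
    · rw [Set.indicator_of_notMem hmem, Set.indicator_of_notMem hmem]
  filter_upwards [ae_mem_limsup_atTop_iff P hsm, ae_all_iff.2 hcond] with ω hω hc
  have hnot : ω ∉ limsup s atTop := by
    rw [mem_limsup_iff_frequently_mem, not_frequently]
    have := hfin fun t => I t ω
    filter_upwards [(tendsto_sub_atTop_nat 1).eventually this] with k hk hmem
    exact hk hmem.2
  rw [hω] at hnot
  simp only [hc] at hnot
  have hnn : ∀ k, 0 ≤ (A' k).indicator (fun _ => q) ω :=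
    fun k => Set.indicator_nonneg (fun _ _ => hq.le) ω
  rw [← not_summable_iff_tendsto_nat_atTop_of_nonneg hnn, not_not] at hnot
  filter_upwards [hnot.tendsto_atTop_zero.eventually_lt_const hq] with k hk hmem
  rw [Set.indicator_of_mem (show ω ∈ A' k from hmem)] at hk
  exact lt_irrefl _ hk

/-- If nonanticipating vectors vanish in the limit along the picked indices, for every realization,
then almost surely they vanish in the limit for all indices. -/
lemma ae_tendsto_zero {E : Type*} [NormedAddCommGroup E] (P : Measure Ω) [IsProbabilityMeasure P]
    {I : ℕ → Ω → Fin n} (hI : ∀ k, Measurable (I k)) (hind : iIndepFun I P) {p : Fin n → ℝ}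
    (hp : ∀ i, 0 < p i) (hlaw : ∀ k i, P {ω | I k ω = i} = ENNReal.ofReal (p i))
    {d : ℕ → (ℕ → Fin n) → Fin n → E}
    (hd : ∀ (k : ℕ) (ξ ξ' : ℕ → Fin n), (∀ t < k, ξ t = ξ' t) → d k ξ = d k ξ')
    (hlim : ∀ ξ : ℕ → Fin n, Tendsto (fun k => ‖d k ξ (ξ k)‖) atTop (𝓝 0)) :
    ∀ᵐ ω ∂P, ∀ i, Tendsto (fun k => d k (fun t => I t ω) i) atTop (𝓝 0) := by
  have hae : ∀ᵐ ω ∂P, ∀ (i : Fin n) (m : ℕ), ∀ᶠ k in atTop,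
      (fun t => I t ω) ∉ {ξ | 1 / ((m : ℝ) + 1) ≤ ‖d k ξ i‖} := by
    refine ae_all_iff.2 fun i => ae_all_iff.2 fun m => ?_
    refine ae_eventually_notMem P hI hind (hp i) (fun k => hlaw k i)
      (A := fun k => {ξ | 1 / ((m : ℝ) + 1) ≤ ‖d k ξ i‖})
      (fun k ξ ξ' hξ => by simp only [Set.mem_ofPred_eq, hd k ξ ξ' hξ]) fun ξ => ?_
    filter_upwards [(hlim ξ).eventually_lt_const (show (0 : ℝ) < 1 / ((m : ℝ) + 1) by positivity)]
      with k hk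
    rintro ⟨h1, rfl⟩
    exact absurd hk (not_lt.2 h1)
  filter_upwards [hae] with ω hω i
  rw [tendsto_zero_iff_norm_tendsto_zero, Metric.tendsto_atTop']
  intro ε hε
  obtain ⟨m, hm⟩ := exists_nat_one_div_lt hε
  obtain ⟨K, hK⟩ := eventually_atTop.1 (hω i m)
  refine ⟨K, fun k hk => ?_⟩
  have := not_le.1 (hK k hk.le)
  rw [dist_zero_right, norm_norm]
  exact this.trans hm

lemma tendsto_integral_zero_of_bounded (P : Measure Ω) [IsProbabilityMeasure P] {g : ℕ → Ω → ℝ}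
    {B : ℝ} (hg : ∀ k, Measurable (g k)) (hB : ∀ k ω, |g k ω| ≤ B)
    (hlim : ∀ᵐ ω ∂P, Tendsto (fun k => g k ω) atTop (𝓝 0)) :
    (∀ k, Integrable (g k) P) ∧ Tendsto (fun k => ∫ ω, g k ω ∂P) atTop (𝓝 0) := by
  refine ⟨fun k => Integrable.of_bound (hg k).aestronglyMeasurable B
    (Eventually.of_forall (hB k)), ?_⟩
  have := tendsto_integral_of_dominated_convergence (fun _ => B)
    (fun k => (hg k).aestronglyMeasurable) (integrable_const B)
    (fun k => Eventually.of_forall (hB k)) hlim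
  simpa using this

lemma exists_ofReal_one_sub_le_measure_lt (P : Measure Ω) [IsProbabilityMeasure P]
    {g : ℕ → Ω → ℝ} (hg : ∀ k, Measurable (g k)) (hg0 : ∀ k ω, 0 ≤ g k ω)
    (hlim : ∀ᵐ ω ∂P, Tendsto (fun k => g k ω) atTop (𝓝 0)) {δ ρ : ℝ} (hδ : 0 < δ) (hρ : 0 < ρ) :
    ∃ K, ∀ k ≥ K, ENNReal.ofReal (1 - ρ) ≤ P {ω | g k ω < δ} := by
  have h1 := tendstoInMeasure_of_tendsto_ae (g := fun _ => (0 : ℝ))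
    (fun k => (hg k).aestronglyMeasurable) hlim
  rw [tendstoInMeasure_iff_norm] at h1
  obtain ⟨K, hK⟩ := eventually_atTop.1
    ((h1 δ hδ).eventually_lt_const (ENNReal.ofReal_pos.2 hρ))
  refine ⟨K, fun k hk => ?_⟩
  have h2 : {ω | g k ω < δ} = {ω | δ ≤ ‖g k ω - 0‖}ᶜ := by
    ext ω
    simp [abs_of_nonneg (hg0 k ω)]
  have hmeas : MeasurableSet {ω | δ ≤ ‖g k ω - 0‖} := by
    simpa [abs_of_nonneg (hg0 k _)] using measurableSet_le measurable_const (hg k)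
  rw [h2, prob_compl_eq_one_sub hmeas, ENNReal.ofReal_sub _ hρ.le, ENNReal.ofReal_one]
  exact tsub_le_tsub_left (hK k hk).le 1

end Probability

end RNBPG

/-! ### Convergence of the method -/

theorem mainTheorem2 {n : ℕ} {N : Fin n → ℕ}
    (f : RNBPG.BlockSpace N → ℝ)
    (Ψ : (i : Fin n) → EuclideanSpace ℝ (Fin (N i)) → EReal)
    (L p : Fin n → ℝ) (η σ θlo θhi : ℝ) (M : ℕ) (x0 : RNBPG.BlockSpace N)
    -- the problem
    (hf : Differentiable ℝ f)
    (hΨ : ∀ i y, Ψ i y ≠ ⊥)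
    (hL : ∀ i, 0 < L i)
    (hfL : RNBPG.BlockLipschitzGradient f L)
    (hopt : ∃ xs, ∀ y, RNBPG.objective f Ψ xs ≤ RNBPG.objective f Ψ y)
    -- the parameters of the method
    (hx0 : RNBPG.objective f Ψ x0 ≠ ⊤)
    (hη : 1 < η) (hσ : 0 < σ) (hθlo : 0 < θlo) (hθ : θlo ≤ θhi)
    (hp : ∀ i, 0 < p i ∧ p i < 1) (hp1 : ∑ i, p i = 1)
    -- the method, with `d k ξ i` the step of iteration `k` for block `i`
    (x : ℕ → (ℕ → Fin n) → RNBPG.BlockSpace N)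
    (d : ℕ → (ℕ → Fin n) → Fin n → RNBPG.BlockSpace N)
    (hrun : RNBPG.IsRun f Ψ η σ θlo θhi M x0 x d)
    -- the random block indices
    {Ω : Type*} [MeasurableSpace Ω] (P : Measure Ω) [IsProbabilityMeasure P]
    (I : ℕ → Ω → Fin n) (hI : ∀ k, Measurable (I k)) (hind : iIndepFun I P)
    (hlaw : ∀ k i, P {ω | I k ω = i} = ENNReal.ofReal (p i))
    -- the random vectors `x^k`, `dbar^k` and `xtilde^k`
    (X D Xt : ℕ → Ω → RNBPG.BlockSpace N)
    (hX : ∀ k ω, X k ω = x k (fun t => I t ω))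
    (hD : ∀ k ω, D k ω = ∑ i, d k (fun t => I t ω) i)
    (hXt : ∀ k ω, Xt k ω = X k ω + D k ω)
    -- the assumptions on the level set
    (hF : UniformContinuousOn (fun y => (RNBPG.objective f Ψ y).toReal)
      (RNBPG.levelSet f Ψ x0))
    (hΨL : ∀ y ∈ RNBPG.levelSet f Ψ x0, RNBPG.LipschitzNear (RNBPG.sep Ψ) y) :
    -- (i)
    ((∀ k, Integrable (fun ω => ‖D k ω‖) P) ∧
      Tendsto (fun k => ∫ ω, ‖D k ω‖ ∂P) atTop (𝓝 0)) ∧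
    ((∃ K : NNReal, LipschitzWith K (gradient f)) →
      Tendsto (fun k => ∫⁻ ω, Metric.infEDist (-gradient f (Xt k ω))
        (RNBPG.clarkeSubdifferential (RNBPG.sep Ψ) (Xt k ω)) ∂P) atTop (𝓝 0)) ∧
    -- (ii)
    ((∀ i, LowerSemicontinuous (Ψ i)) →
      ∀ᵐ ω ∂P, ∀ z, MapClusterPt z atTop (fun k => X k ω) → RNBPG.IsStationary f Ψ z) ∧
    -- (iii)
    ((∃ K : NNReal, LipschitzWith K (gradient f)) →
      UniformContinuousOn (fun y => (RNBPG.objective f Ψ y).toReal)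
        (RNBPG.enlargedLevelSet f Ψ L σ θlo x0) →
      (∀ k ω, RNBPG.objective f Ψ (X k ω) ≠ ⊤ ∧ RNBPG.objective f Ψ (Xt k ω) ≠ ⊤) ∧
      (∀ k, Integrable (fun ω => |(RNBPG.objective f Ψ (X k ω)).toReal -
        (RNBPG.objective f Ψ (Xt k ω)).toReal|) P) ∧
      Tendsto (fun k => ∫ ω, |(RNBPG.objective f Ψ (X k ω)).toReal -
        (RNBPG.objective f Ψ (Xt k ω)).toReal| ∂P) atTop (𝓝 0) ∧
      ∀ ε > (0 : ℝ), ∀ ρ ∈ Set.Ioo (0 : ℝ) 1, ∃ K : ℕ, ∀ k ≥ K,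
        ENNReal.ofReal (1 - ρ) ≤ P {ω |
          ‖X k ω - Xt k ω‖ ≤ ε ∧
          |(RNBPG.objective f Ψ (X k ω)).toReal -
            (RNBPG.objective f Ψ (Xt k ω)).toReal| ≤ ε ∧
          Metric.infEDist (-gradient f (Xt k ω))
            (RNBPG.clarkeSubdifferential (RNBPG.sep Ψ) (Xt k ω)) ≤ ENNReal.ofReal ε}) := by
  obtain ⟨xs, hxs⟩ := hopt
  have h : RNBPG.AdmissibleRun f Ψ L η σ θlo θhi M x0 xs x d :=
    { toIsRun := hrun, differentiable := hf, ne_bot := hΨ, pos := hL, blockLipschitz := hfL,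
      isMin := hxs, ne_top := hx0, one_lt_η := hη, σ_pos := hσ, θlo_pos := hθlo, θlo_le := hθ,
      uniformContinuousOn := hF, lipschitzNear := hΨL }
  have i₀ : Fin n := by
    rcases n with _ | n
    · simp at hp1
    · exact 0
  have hXt' : ∀ k ω, Xt k ω = x k (fun t => I t ω) + ∑ i, d k (fun t => I t ω) i :=
    fun k ω => by rw [hXt, hX, hD]
  have hae : ∀ᵐ ω ∂P, Tendsto (fun k => D k ω) atTop (𝓝 0) := by
    filter_upwards [RNBPG.ae_tendsto_zero P hI hind (fun i => (hp i).1) hlaw hrun.nonanticipating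
      h.tendsto_norm_step] with ω hω
    simp only [hD]
    simpa using tendsto_finsetSum Finset.univ fun i _ => hω i
  have hae' : ∀ᵐ ω ∂P, Tendsto (fun k => ‖D k ω‖) atTop (𝓝 0) := by
    filter_upwards [hae] with ω hω
    simpa using hω.norm
  obtain ⟨B, hB⟩ := h.exists_norm_sum_le
  have hDB : ∀ k ω, |‖D k ω‖| ≤ B := fun k ω => by rw [abs_norm, hD]; exact hB k _
  have hDm : ∀ k, Measurable fun ω => ‖D k ω‖ := fun k => by
    simp only [hD]
    exact (RNBPG.measurable_of_nonanticipating I hI (k := k) (G := fun ξ => ‖∑ i, d k ξ i‖)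
      (fun ξ ξ' hξ => by rw [hrun.nonanticipating k ξ ξ' hξ]) i₀).mono
      ((RNBPG.pastFiltration I hI).le k) le_rfl
  obtain ⟨hDint, hDlim⟩ := RNBPG.tendsto_integral_zero_of_bounded P hDm hDB hae'
  refine ⟨⟨hDint, hDlim⟩, ?_, ?_, ?_⟩
  · rintro ⟨K, hK⟩
    set C := max θhi (η * (∑ j, L j + σ)) + K with hC
    have hC0 : 0 ≤ C := add_nonneg (le_max_of_le_left (hθlo.le.trans hθ)) K.coe_nonneg
    have hlim : Tendsto (fun k => ENNReal.ofReal (C * ∫ ω, ‖D k ω‖ ∂P)) atTop (𝓝 0) := by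
      simpa using ENNReal.tendsto_ofReal (hDlim.const_mul C)
    refine tendsto_of_tendsto_of_tendsto_of_le_of_le tendsto_const_nhds hlim
      (fun _ => zero_le) fun k => ?_
    rw [← integral_const_mul, ofReal_integral_eq_lintegral_ofReal ((hDint k).const_mul C)
      (Eventually.of_forall fun ω => mul_nonneg hC0 (norm_nonneg _))]
    refine lintegral_mono fun ω => ?_
    simp only [hXt', hD]
    exact h.infEDist_le hK k _
  · intro hlsc
    filter_upwards [hae] with ω hω z hz
    simp only [hD] at hω
    simp only [hX] at hz
    exact h.isStationary_of_mapClusterPt hlsc hω hz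
  · rintro ⟨K, hK⟩ hS
    have hXmem : ∀ k ω, X k ω ∈ RNBPG.levelSet f Ψ x0 := fun k ω => by
      rw [hX]; exact h.mem_levelSet k _
    have hXtop : ∀ k ω, RNBPG.objective f Ψ (X k ω) ≠ ⊤ :=
      fun k ω => h.ne_top_of_mem_levelSet (hXmem k ω)
    have hXttop : ∀ k ω, RNBPG.objective f Ψ (Xt k ω) ≠ ⊤ := fun k ω => by
      rw [hXt']; exact h.ne_top_add_sum k _
    have hclose : ∀ ε > (0 : ℝ), ∃ δ > (0 : ℝ), ∀ k ω, ‖D k ω‖ < δ →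
        |(RNBPG.objective f Ψ (X k ω)).toReal - (RNBPG.objective f Ψ (Xt k ω)).toReal| < ε := by
      intro ε hε
      obtain ⟨δ, hδ, hd⟩ := h.exists_abs_sub_lt hK hS hε
      refine ⟨δ, hδ, fun k ω hk => ?_⟩
      rw [hX, hXt']
      exact hd k _ (by rwa [← hD])
    have hgm : ∀ k, Measurable fun ω => |(RNBPG.objective f Ψ (X k ω)).toReal -
        (RNBPG.objective f Ψ (Xt k ω)).toReal| := fun k => by
      simp only [hX, hXt']
      exact (RNBPG.measurable_of_nonanticipating I hI (k := k)
        (G := fun ξ => |(RNBPG.objective f Ψ (x k ξ)).toReal -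
          (RNBPG.objective f Ψ (x k ξ + ∑ i, d k ξ i)).toReal|)
        (fun ξ ξ' hξ => by rw [hrun.nonanticipating k ξ ξ' hξ, h.iterate_eq k hξ]) i₀).mono
        ((RNBPG.pastFiltration I hI).le k) le_rfl
    have hgB : ∀ k ω, |(|(RNBPG.objective f Ψ (X k ω)).toReal -
        (RNBPG.objective f Ψ (Xt k ω)).toReal|)| ≤ (RNBPG.objective f Ψ x0).toReal -
          (RNBPG.objective f Ψ xs).toReal + K / 2 * B ^ 2 := fun k ω => by
      have h1 := h.toReal_le_of_mem_levelSet (hXmem k ω)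
      have h2 := h.toReal_min_le (hXtop k ω)
      have h3 := h.toReal_min_le (hXttop k ω)
      have h4 := h.toReal_add_sum_le hK k fun t => I t ω
      have h5 := hB k fun t => I t ω
      rw [← hXt'] at h4
      have h6 : (K : ℝ) / 2 * ‖∑ i, d k (fun t => I t ω) i‖ ^ 2 ≤ K / 2 * B ^ 2 := by gcongr
      have h7 : 0 ≤ (K : ℝ) / 2 * B ^ 2 := by positivity
      rw [abs_abs, abs_le]
      constructor <;> linarith
    have hglim : ∀ᵐ ω ∂P, Tendsto (fun k => |(RNBPG.objective f Ψ (X k ω)).toReal -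
        (RNBPG.objective f Ψ (Xt k ω)).toReal|) atTop (𝓝 0) := by
      filter_upwards [hae'] with ω hω
      refine Metric.tendsto_nhds.2 fun ε hε => ?_
      obtain ⟨δ, hδ, hd⟩ := hclose ε hε
      filter_upwards [hω.eventually_lt_const hδ] with k hk
      rw [Real.dist_eq, sub_zero, abs_abs]
      exact hd k ω hk
    obtain ⟨hgint, hgl⟩ := RNBPG.tendsto_integral_zero_of_bounded P hgm hgB hglim
    refine ⟨fun k ω => ⟨hXtop k ω, hXttop k ω⟩, hgint, hgl, fun ε hε ρ hρ => ?_⟩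
    obtain ⟨δ, hδ, hd⟩ := hclose ε hε
    set C := max θhi (η * (∑ j, L j + σ)) + K with hC
    have hC0 : 0 ≤ C := add_nonneg (le_max_of_le_left (hθlo.le.trans hθ)) K.coe_nonneg
    -- all three quantities are at most `ε` once `‖D k ω‖` is below this threshold
    obtain ⟨k₀, hk₀⟩ := RNBPG.exists_ofReal_one_sub_le_measure_lt P hDm
      (fun k ω => norm_nonneg _) hae' (δ := min δ (ε / (C + 1))) (lt_min hδ (by positivity)) hρ.1
    refine ⟨k₀, fun k hk => (hk₀ k hk).trans (measure_mono fun ω hω => ?_)⟩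
    obtain ⟨hω1, hω2⟩ := lt_min_iff.1 (show ‖D k ω‖ < min δ (ε / (C + 1)) from hω)
    rw [lt_div_iff₀ (by positivity)] at hω2
    have h1 : 0 ≤ C * ‖D k ω‖ := mul_nonneg hC0 (norm_nonneg _)
    refine ⟨?_, (hd k ω hω1).le, ?_⟩
    · rw [hXt, norm_sub_rev, add_sub_cancel_left]
      nlinarith [norm_nonneg (D k ω)]
    · have h2 := h.infEDist_le hK k fun t => I t ω
      rw [← hXt', ← hD] at h2
      exact h2.trans (ENNReal.ofReal_le_ofReal (by nlinarith [norm_nonneg (D k ω)]))
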